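/- For $\lambda \in \mathbb{C} \setminus \{0,1\}$ let $E_\lambda \colon y^2 = x(x-1)(x-\lambda)$ be the Legendre elliptic curve. For $\alpha \in \mathbb{C} \setminus \{0,1\}$ let $P_\alpha(\lambda)$ be a point of $E_\lambda(\mathbb{C})$ with $x$-coordinate $\alpha$, put $$T(\alpha) = \{\lambda \in \mathbb{C} \setminus \{0,1\} : P_\alpha(\lambda) \text{ is a torsion point of } E_\lambda\}$$ and $T(\alpha,\beta) = T(\alpha) \cap T(\beta)$. Let $\bar{\mathbb{Q}} \subset \mathbb{C}$ be the field of algebraic numbers, fix an embedding $i \colon \bar{\mathbb{Q}} \hookrightarrow \bar{\mathbb{Q}}_2$, and let $\rho \colon \bar{\mathbb{Q}} \to \mathbb{P}^1(\bar{\mathbb{F}}_2) = \bar{\mathbb{F}}_2 \cup \{\infty\}$ be the associated reduction map, where $\bar{\mathbb{F}}_2$ is the residue field of $\bar{\mathbb{Q}}_2$: if $i(\alpha)$ is integral, then $\rho(\alpha)$ is its residue class, and otherwise $\rho(\alpha) = \infty$. Let $\alpha, \beta \in \bar{\mathbb{Q}} \setminus \{0,1\}$ be such that $\rho(\alpha)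 \neq \rho(\beta)$. Then $$T(\alpha,\beta) \subseteq \{\alpha,\beta\}.$$ In particular, $T(\alpha,\beta)$ is finite and effectively computable. The latter means: there is a single algorithm (a partial recursive function, independent of $i$, $\alpha$, $\beta$) with the following property. Its input consists of integer coefficients of a polynomial $m$ that is irreducible over $\mathbb{Q}$ and of two polynomials $a, b \in \mathbb{Q}[X]$. Whenever $\theta \in \bar{\mathbb{Q}}$ is a root of $m$ and $\alpha = a(\theta)$, $\beta = b(\theta)$ satisfy the hypotheses above (for some $i$), the algorithm terminates and returns a finite list of polynomials $c_1, \dots, c_r \in \mathbb{Q}[X]$ such that $T(\alpha,\beta) = \{c_1(\theta), \dots, c_r(\theta)\}$. -/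

import Mathlib

open Polynomial
open scoped Valued

noncomputable section

/-- The Legendre curve `E_lam : y² = x (x - 1) (x - lam) = x³ - (1 + lam) x² + lam x` over `ℂ`. -/
def legendreCurve (lam : ℂ) : WeierstrassCurve.Affine ℂ where
  a₁ := 0
  a₂ := -(1 + lam)
  a₃ := 0
  a₄ := lam
  a₆ := 0

/-- `T(α)`: the set of parameters `lam ∈ ℂ \ {0, 1}` such that a point `P_α(lam)` of `E_lam` with
`x`-coordinate `α` is torsion. The (at most two) points with a given `x`-coordinate are
negatives of each other, so the choice of the point does not matter. -/
def torsionParams (α : ℂ) : Set ℂ :=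
  {lam : ℂ | lam ≠ 0 ∧ lam ≠ 1 ∧
    ∃ (y : ℂ) (h : (legendreCurve lam).Nonsingular α y),
      IsOfFinAddOrder (WeierstrassCurve.Affine.Point.some α y h)}

/-- `T(α, β) = T(α) ∩ T(β)`. -/
def simultaneousTorsionParams (α β : ℂ) : Set ℂ :=
  torsionParams α ∩ torsionParams β

/-- The field of algebraic numbers, as a subfield of `ℂ`. -/
abbrev QBar : Type := algebraicClosure ℚ ℂ

/-- The projective line over the residue field `𝔽̄₂` of the ring of integers of `ℚ̄₂`, in the form
`𝔽̄₂ ∪ {∞}`. -/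
abbrev ResidueLine : Type := OnePoint 𝓀[PadicAlgCl 2]

open Classical in
/-- The `2`-adic reduction map `ρ : ℚ̄ → ℙ¹(ℚ̄₂) → ℙ¹(𝔽̄₂)` attached to an embedding
`i : ℚ̄ → ℚ̄₂`: an element that is integral at `2` goes to its residue class, every other element
goes to `∞`. -/
def reduction (i : QBar →+* PadicAlgCl 2) (x : QBar) : ResidueLine :=
  if h : i x ∈ 𝒪[PadicAlgCl 2] then
    ((IsLocalRing.residue 𝒪[PadicAlgCl 2] ⟨i x, h⟩ : 𝓀[PadicAlgCl 2]) : ResidueLine)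
  else OnePoint.infty

/-- The integer polynomial `c₀ + c₁ X + c₂ X² + ⋯` with coefficient list `[c₀, c₁, c₂, …]`. -/
def polyOfList : List ℤ → ℤ[X]
  | [] => 0
  | c :: cs => C c + X * polyOfList cs

/-- Finite data for an element of a number field `ℚ(θ)`: a list `[c₀, c₁, …]` of integers and a
natural number `d`. -/
abbrev ElementCode : Type := List ℤ × ℕ

/-- The element `(c₀ + c₁ θ + c₂ θ² + ⋯) / (d + 1)` of `ℚ(θ)` given by the data `(c, d)`. -/
def ElementCode.value (θ : QBar) (c : ElementCode) : QBar :=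
  aeval θ (polyOfList c.1) / ((c.2 : QBar) + 1)

/-- Finite data for a pair of algebraic numbers: an integer polynomial `m` (as a coefficient list)
and two elements of the field generated by a root of `m`. -/
abbrev PairCode : Type := List ℤ × ElementCode × ElementCode

/-- The data `(m, a, b)` describe the pair `(α, β)` by means of `θ`: the polynomial `m` is
irreducible over `ℚ`, `θ` is a root of it, and `α = a(θ)`, `β = b(θ)` in `ℚ(θ) ≅ ℚ[X] / (m)`. -/
def PairCode.Describes (c : PairCode) (θ α β : QBar) : Prop :=
  Irreducible ((polyOfList c.1).map (Int.castRingHom ℚ)) ∧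
    aeval θ (polyOfList c.1) = 0 ∧
    ElementCode.value θ c.2.1 = α ∧
    ElementCode.value θ c.2.2 = β

end

/-!
Let `v` be the valuation of a valuation ring of `ℂ` in which `2` is not a unit. The argument rests
on the duplication formula `x(2P) = (x² - lam)² / (4 x (x - 1) (x - lam))` on `E_lam`. If `v x`
exceeds `max 1 (v lam)`, then `v (x(2P)) = v x / v 4` is larger still, so the points `2 ^ k • P`
are all distinct and `P` is not torsion. Hence `v x ≤ max 1 (v lam)` at every torsion point other
than zero (`IsTorsionX.valuation_le`).

*The inclusion.* Let `x ≠ 0, 1, lam` be the abscissa of a torsion point. Applied to `2P`, the bound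
forces `x² ≡ lam` if `lam` is integral, and forces `x` to be nonintegral otherwise, because of the
factor `4` in the denominator of the formula. The embedding of the algebraic numbers into `ℚ̄₂`
induces a valuation ring which extends to `ℂ`, so this applies to every complex `lam`. If `lam`
belongs to both `T(α)` and `T(β)` and differs from `α` and `β`, then the reductions of `α` and `β`
have the same square, hence are equal (`simultaneousTorsionParams_subset`).

*The algorithm.* Since `α ∈ T(α)`, it remains to decide whether `α ∈ T(β)` and whether `β ∈ T(α)`,
that is, whether a given point `P` of a given curve `E_lam` over a number field `ℚ(θ)` is torsion.
This is the case if two of the points `2 ^ k • P` have the same abscissa or one of them is zero.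
Conversely, translation by the points of order two and the formula
`x(P + Q) x(P - Q) (x(P) - x(Q))² = (x(P) x(Q) - lam)²` turn the bound above into a lower bound for
the distance of the abscissas of two torsion points (`IsTorsionX.separation`). As a finitely
generated subgroup of `ℚ(θ)` is free of rank at most `[ℚ(θ) : ℚ]`, an integral family of more than
`2 ^ (L t)` elements contains two that are congruent modulo `2 ^ t`, where `L` bounds the degree
(`exists_congruent`). So for torsion `P` a coincidence occurs before an explicit bound
(`exists_eq_of_isTorsionX`).

Both alternatives are witnessed by identities between integer polynomials: a coincidence is the
vanishing at `θ` of a certain integer polynomial, certified by divisibility by the polynomial `m` of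
`θ`; the absence of coincidences up to the bound is certified by a Bézout identity with `m`, and so
are the lower bounds for `lam` and `1 - lam` that enter the bound. The identities are primitive
recursive in the coefficient lists, and the algorithm searches for one of the two certificates
(`exists_cert`, `exists_decision`).
-/

/-! ### The group law on Legendre curves -/

/-- `x` is the abscissa of a torsion point other than zero of the Legendre curve `E_lam`. -/
def IsTorsionX (lam x : ℂ) : Prop :=
  ∃ (y : ℂ) (h : (legendreCurve lam).Nonsingular x y),
    IsOfFinAddOrder (WeierstrassCurve.Affine.Point.some x y h)

namespace legendreCurve

open WeierstrassCurve.Affine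

variable {lam x y : ℂ}

theorem equation_iff :
    (legendreCurve lam).Equation x y ↔ y ^ 2 = x * (x - 1) * (x - lam) := by
  rw [WeierstrassCurve.Affine.equation_iff]
  simp only [legendreCurve]
  constructor <;> intro h <;> linear_combination h

theorem nonsingular_iff (h0 : lam ≠ 0) (h1 : lam ≠ 1) :
    (legendreCurve lam).Nonsingular x y ↔ y ^ 2 = x * (x - 1) * (x - lam) := by
  rw [WeierstrassCurve.Affine.nonsingular_iff', equation_iff]
  simp only [legendreCurve]
  refine ⟨fun h => h.1, fun h => ⟨h, ?_⟩⟩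
  by_contra! H
  obtain ⟨H1, H2⟩ := H
  have hy : y = 0 := by linear_combination H2 / 2
  subst hy
  have H1 : 3 * x ^ 2 - 2 * (1 + lam) * x + lam = 0 := by linear_combination -H1
  have h : x * (x - 1) * (x - lam) = 0 := by linear_combination -h
  rcases mul_eq_zero.1 h with h | h
  · rcases mul_eq_zero.1 h with h | h
    · subst h; apply h0; linear_combination H1
    · obtain rfl := sub_eq_zero.1 h; apply h1; linear_combination -H1
  · obtain rfl := sub_eq_zero.1 h
    have : x * (x - 1) = 0 := by linear_combination H1
    rcases mul_eq_zero.1 this with h | h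
    · exact h0 h
    · exact h1 (sub_eq_zero.1 h)

theorem exists_nonsingular (h0 : lam ≠ 0) (h1 : lam ≠ 1) (x : ℂ) :
    ∃ y, (legendreCurve lam).Nonsingular x y := by
  obtain ⟨y, hy⟩ := IsAlgClosed.exists_pow_nat_eq (x * (x - 1) * (x - lam)) two_pos
  exact ⟨y, (nonsingular_iff h0 h1).2 hy⟩

/-- The abscissa of the sum of two points with different abscissas. -/
theorem exists_add_eq_some {x₁ y₁ x₂ y₂ : ℂ} (P₁ : (legendreCurve lam).Nonsingular x₁ y₁)
    (P₂ : (legendreCurve lam).Nonsingular x₂ y₂) (hx : x₁ ≠ x₂) :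
    ∃ X Y, ∃ h : (legendreCurve lam).Nonsingular X Y,
      Point.some x₁ y₁ P₁ + Point.some x₂ y₂ P₂ = Point.some X Y h ∧
      X = ((y₁ - y₂) / (x₁ - x₂)) ^ 2 + (1 + lam) - x₁ - x₂ := by
  refine ⟨_, _, _, Point.add_of_X_ne hx, ?_⟩
  rw [slope_of_X_ne hx]
  simp only [addX, legendreCurve]
  ring

/-- The abscissa of twice a point that is not of order two. -/
theorem exists_add_self_eq_some (P : (legendreCurve lam).Nonsingular x y) (hy : y ≠ 0) :
    ∃ Y, ∃ h : (legendreCurve lam).Nonsingular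
        ((x ^ 2 - lam) ^ 2 / (4 * x * (x - 1) * (x - lam))) Y,
      Point.some x y P + Point.some x y P = Point.some _ Y h := by
  have hneg : y ≠ (legendreCurve lam).negY x y := by
    simp only [negY, legendreCurve]
    intro h
    apply hy
    linear_combination h / 2
  have he := equation_iff.1 P.1
  -- The tangent formula has denominator `(2 y)²`, which the equation of the curve rewrites.
  have hX : (legendreCurve lam).addX x x ((legendreCurve lam).slope x x y y) =
      (x ^ 2 - lam) ^ 2 / (4 * x * (x - 1) * (x - lam)) := by
    rw [slope_of_Y_ne rfl hneg]
    have h4 : 4 * x * (x - 1) * (x - lam) = (2 * y) ^ 2 := by linear_combination -4 * he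
    have h2 : y - (legendreCurve lam).negY x y = 2 * y := by
      simp only [negY, legendreCurve]; ring
    rw [h4, h2]
    simp only [addX, legendreCurve]
    field_simp
    linear_combination (4 * (1 + lam) - 8 * x) * he
  have hP := Point.add_self_of_Y_ne (h₁ := P) hneg
  exact ⟨_, hX ▸ nonsingular_add P P fun h => hneg h.2, by rw [hP]; simp only [hX]⟩

theorem y_eq_zero_iff (P : (legendreCurve lam).Nonsingular x y) :
    y = 0 ↔ x = 0 ∨ x = 1 ∨ x = lam := by
  rw [← pow_eq_zero_iff two_ne_zero, equation_iff.1 P.1]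
  simp only [mul_eq_zero, sub_eq_zero, or_assoc]

/-- A point with `y = 0` is its own negative. -/
theorem add_self_eq_zero (P : (legendreCurve lam).Nonsingular x y) (hy : y = 0) :
    Point.some x y P + Point.some x y P = 0 := by
  apply Point.add_self_of_Y_eq
  simp [negY, legendreCurve, hy]

/-- The points over the finite branch points `0`, `1`, `lam` have order two. -/
theorem exists_isOfFinAddOrder_branch (h0 : lam ≠ 0) (h1 : lam ≠ 1) (hx : x = 0 ∨ x = 1 ∨ x = lam) :
    ∃ h : (legendreCurve lam).Nonsingular x 0, IsOfFinAddOrder (Point.some x 0 h) := by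
  have h : (legendreCurve lam).Nonsingular x 0 := by
    rw [nonsingular_iff h0 h1]
    rcases hx with rfl | rfl | rfl <;> ring
  exact ⟨h, isOfFinAddOrder_iff_nsmul_eq_zero.2 ⟨2, two_pos, by
    rw [two_nsmul]; exact add_self_eq_zero h rfl⟩⟩

end legendreCurve

namespace IsTorsionX

open WeierstrassCurve.Affine legendreCurve

variable {lam x x₁ x₂ : ℂ}

theorem double (h : IsTorsionX lam x) (hx0 : x ≠ 0) (hx1 : x ≠ 1) (hxl : x ≠ lam) :
    IsTorsionX lam ((x ^ 2 - lam) ^ 2 / (4 * x * (x - 1) * (x - lam))) := by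
  obtain ⟨y, P, hP⟩ := h
  have hy : y ≠ 0 := by rw [Ne, y_eq_zero_iff P]; tauto
  obtain ⟨Y, H, e⟩ := exists_add_self_eq_some P hy
  exact ⟨Y, H, e ▸ hP.add hP⟩

/-- Adding the point `(0, 0)` of order two sends `x` to `lam / x`. -/
theorem translate_zero (h0 : lam ≠ 0) (h1 : lam ≠ 1) (h : IsTorsionX lam x) (hx : x ≠ 0) :
    IsTorsionX lam (lam / x) := by
  obtain ⟨y, P, hP⟩ := h
  obtain ⟨Q, hQ⟩ := exists_isOfFinAddOrder_branch h0 h1 (x := 0) (by simp)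
  obtain ⟨X, Y, H, e, hX⟩ := exists_add_eq_some P Q hx
  have : X = lam / x := by
    rw [hX, sub_zero, sub_zero, div_pow, equation_iff.1 P.1]
    field_simp
    ring
  subst this
  exact ⟨Y, H, e ▸ hP.add hQ⟩

/-- Adding the point `(1, 0)` of order two sends `x` to `(x - lam) / (x - 1)`. -/
theorem translate_one (h0 : lam ≠ 0) (h1 : lam ≠ 1) (h : IsTorsionX lam x) (hx : x ≠ 1) :
    IsTorsionX lam ((x - lam) / (x - 1)) := by
  obtain ⟨y, P, hP⟩ := h
  obtain ⟨Q, hQ⟩ := exists_isOfFinAddOrder_branch h0 h1 (x := 1) (by simp)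
  obtain ⟨X, Y, H, e, hX⟩ := exists_add_eq_some P Q hx
  have : X = (x - lam) / (x - 1) := by
    have := sub_ne_zero.2 hx
    rw [hX, sub_zero, div_pow, equation_iff.1 P.1]
    field_simp
    ring
  subst this
  exact ⟨Y, H, e ▸ hP.add hQ⟩

/-- The product of the abscissas `s`, `t` of the sum and the difference of two points depends on
their abscissas only. -/
theorem exists_mul_eq (h₁ : IsTorsionX lam x₁) (h₂ : IsTorsionX lam x₂) (hx : x₁ ≠ x₂) :
    ∃ s t, IsTorsionX lam s ∧ IsTorsionX lam t ∧
      s * t * (x₁ - x₂) ^ 2 = (x₁ * x₂ - lam) ^ 2 := by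
  obtain ⟨y₁, P, hP⟩ := h₁
  obtain ⟨y₂, Q, hQ⟩ := h₂
  have hQ' : IsOfFinAddOrder (-Point.some x₂ y₂ Q) := hQ.neg
  rw [Point.neg_some] at hQ'
  obtain ⟨X, Y, H, e, hX⟩ := exists_add_eq_some P Q hx
  obtain ⟨X', Y', H', e', hX'⟩ := exists_add_eq_some P ((nonsingular_neg x₂ y₂).2 Q) hx
  refine ⟨X, X', ⟨Y, H, e ▸ hP.add hQ⟩, ⟨Y', H', e' ▸ hP.add hQ'⟩, ?_⟩
  have hd := sub_ne_zero.2 hx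
  have hn : (legendreCurve lam).negY x₂ y₂ = -y₂ := by simp [negY, legendreCurve]
  have e1 := equation_iff.1 P.1
  have e2 := equation_iff.1 Q.1
  rw [hn] at hX'
  -- `s` and `t` are the values of `S²/(x₁-x₂)² + 1 + lam - x₁ - x₂` at `S = y₁ ∓ y₂`.
  have k1 : X * (x₁ - x₂) ^ 2 = (y₁ - y₂) ^ 2 + (1 + lam - x₁ - x₂) * (x₁ - x₂) ^ 2 := by
    rw [hX]; field_simp; ring
  have k2 : X' * (x₁ - x₂) ^ 2 = (y₁ + y₂) ^ 2 + (1 + lam - x₁ - x₂) * (x₁ - x₂) ^ 2 := by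
    rw [hX']; field_simp; ring
  have hd2 : (x₁ - x₂) ^ 2 ≠ 0 := pow_ne_zero 2 hd
  apply mul_right_cancel₀ hd2
  have : X * X' * (x₁ - x₂) ^ 2 * (x₁ - x₂) ^ 2 =
      (X * (x₁ - x₂) ^ 2) * (X' * (x₁ - x₂) ^ 2) := by ring
  rw [this, k1, k2]
  have k3 : ((y₁ - y₂) ^ 2 + (1 + lam - x₁ - x₂) * (x₁ - x₂) ^ 2) *
      ((y₁ + y₂) ^ 2 + (1 + lam - x₁ - x₂) * (x₁ - x₂) ^ 2) =
      (y₁ ^ 2 - y₂ ^ 2) ^ 2 + 2 * (1 + lam - x₁ - x₂) * (x₁ - x₂) ^ 2 * (y₁ ^ 2 + y₂ ^ 2) +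
      (1 + lam - x₁ - x₂) ^ 2 * (x₁ - x₂) ^ 4 := by ring
  rw [k3, e1, e2]
  ring

end IsTorsionX

/-! ### Torsion points in the `2`-adic metric -/

section Valuation

open WeierstrassCurve.Affine legendreCurve

variable {Γ₀ : Type*} [LinearOrderedCommGroupWithZero Γ₀] (v : Valuation ℂ Γ₀) {lam x x₁ x₂ : ℂ}

/-- Far away from the branch points, doubling multiplies the `2`-adic absolute value of the
abscissa by `|4|⁻¹`. -/
theorem valuation_double (hx : max 1 (v lam) < v x) :
    v ((x ^ 2 - lam) ^ 2 / (4 * x * (x - 1) * (x - lam))) * v 4 = v x := by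
  obtain ⟨h1, hl⟩ := max_lt_iff.1 hx
  have hx0 : v x ≠ 0 := (zero_lt_one.trans h1).ne'
  have e1 : v (x - 1) = v x := v.map_sub_eq_of_lt_left (by simpa using h1)
  have e2 : v (x - lam) = v x := v.map_sub_eq_of_lt_left hl
  have e3 : v (x ^ 2 - lam) = v x ^ 2 := by
    rw [← map_pow]
    apply v.map_sub_eq_of_lt_left
    rw [map_pow, sq]
    exact hl.trans_le (le_mul_of_one_le_left' h1.le)
  have h4 : v 4 ≠ 0 := (v.ne_zero_iff).2 (by norm_num)
  simp only [map_div₀, map_mul, map_pow, e1, e2, e3]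
  field_simp

theorem valuation_four_lt_one (hv : v 2 < 1) : v 4 < 1 := by
  have : (4 : ℂ) = 2 * 2 := by norm_num
  rw [this, map_mul]
  exact mul_lt_one' hv hv

/-- Torsion points stay close to the branch points in the `2`-adic metric: otherwise the absolute
values of the abscissas would grow forever under doubling. -/
theorem IsTorsionX.valuation_le (hv : v 2 < 1) (h : IsTorsionX lam x) :
    v x ≤ max 1 (v lam) := by
  classical
  by_contra! hx
  obtain ⟨y, P, hP⟩ := h
  have h4 := valuation_four_lt_one v hv
  let f : (legendreCurve lam).Point → Γ₀ := fun Q => Point.casesOn Q 0 fun x _ _ => v x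
  have hfin : (AddSubmonoid.multiples (Point.some x y P) :
      Set (legendreCurve lam).Point).Finite :=
    hP.finite_multiples
  -- A multiple whose abscissa has the largest absolute value contradicts `valuation_double`.
  obtain ⟨Q, hQ, hmax⟩ := Set.exists_max_image _ f hfin ⟨_, AddSubmonoid.mem_multiples _⟩
  have hQx : max 1 (v lam) < f Q := hx.trans_le (hmax _ (AddSubmonoid.mem_multiples _))
  rcases Q with _ | ⟨X, Y, H⟩
  · exact absurd hQx (not_lt_of_ge zero_le)
  · have hX : max 1 (v lam) < v X := hQx
    obtain ⟨h1, hl⟩ := max_lt_iff.1 hX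
    have hY : Y ≠ 0 := by
      rw [Ne, y_eq_zero_iff H]
      rintro (rfl | rfl | rfl)
      · simp at h1
      · simp at h1
      · exact hl.false
    obtain ⟨Y', H', e⟩ := exists_add_self_eq_some H hY
    have hle := hmax _ (add_mem hQ hQ)
    rw [e] at hle
    have hd := valuation_double v hX
    have hle : v ((X ^ 2 - lam) ^ 2 / (4 * X * (X - 1) * (X - lam))) ≤ v X := hle
    have : v X < v X := by
      calc v X = _ := hd.symm
        _ ≤ v X * v 4 := by gcongr
        _ < v X := mul_lt_of_lt_one_right (zero_lt_one.trans h1) h4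
    exact this.false

/-- The valuation of the duplication formula, with the denominator cleared. -/
theorem valuation_double_mul (hx0 : x ≠ 0) (hx1 : x ≠ 1) (hxl : x ≠ lam) :
    v ((x ^ 2 - lam) ^ 2 / (4 * x * (x - 1) * (x - lam))) *
      (v 4 * v x * v (x - 1) * v (x - lam)) = v (x ^ 2 - lam) ^ 2 := by
  rw [← map_mul, ← map_mul, ← map_mul, ← map_mul, ← map_pow]
  congr 1
  have := sub_ne_zero.2 hx1
  have := sub_ne_zero.2 hxl
  field_simp

/-- If `lam` is integral, then the reduction of `lam` is the square of that of `x`. -/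
theorem IsTorsionX.valuation_sq_sub_lt_one (hv : v 2 < 1) (h : IsTorsionX lam x) (hx0 : x ≠ 0)
    (hx1 : x ≠ 1) (hxl : x ≠ lam) (hl : v lam ≤ 1) : v (x ^ 2 - lam) < 1 := by
  have hx : v x ≤ 1 := by simpa [hl] using h.valuation_le v hv
  have hd := (h.double hx0 hx1 hxl).valuation_le v hv
  rw [max_eq_left hl] at hd
  have e := valuation_double_mul v hx0 hx1 hxl
  have h1 : v (x - 1) ≤ 1 := v.map_sub_le hx (by simp)
  have h2 : v (x - lam) ≤ 1 := v.map_sub_le hx hl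
  have : v (x ^ 2 - lam) ^ 2 < 1 := by
    rw [← e]
    calc _ ≤ 1 * (v 4 * 1 * 1 * 1) := by gcongr
      _ < 1 := by simpa using valuation_four_lt_one v hv
  by_contra! hc
  exact this.not_ge (one_le_pow₀ hc)

/-- If `lam` reduces to infinity, then so does `x`. -/
theorem IsTorsionX.one_lt_valuation (hv : v 2 < 1) (h : IsTorsionX lam x) (hx0 : x ≠ 0)
    (hx1 : x ≠ 1) (hxl : x ≠ lam) (hl : 1 < v lam) : 1 < v x := by
  by_contra! hx
  have hd := (h.double hx0 hx1 hxl).valuation_le v hv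
  rw [max_eq_right hl.le] at hd
  have e := valuation_double_mul v hx0 hx1 hxl
  have h1 : v (x - 1) ≤ 1 := v.map_sub_le hx (by simp)
  have h2 : v (x - lam) = v lam := v.map_sub_eq_of_lt_right (hx.trans_lt hl)
  have h3 : v (x ^ 2 - lam) = v lam := by
    apply v.map_sub_eq_of_lt_right
    rw [map_pow]
    exact (pow_le_one' hx 2).trans_lt hl
  rw [h2, h3] at e
  have hl0 : 0 < v lam := zero_lt_one.trans hl
  have : v lam ^ 2 < v lam ^ 2 := by
    calc v lam ^ 2 = _ := e.symm
      _ ≤ v lam * (v 4 * 1 * 1 * v lam) := by gcongr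
      _ = v lam ^ 2 * v 4 := by rw [mul_one, mul_one, sq]; ac_rfl
      _ < v lam ^ 2 := mul_lt_of_lt_one_right (pow_pos hl0 2) (valuation_four_lt_one v hv)
  exact this.false

/-- The bound `valuation_le` for the translate by `(0, 0)`. -/
theorem IsTorsionX.valuation_param_le (hv : v 2 < 1) (h0 : lam ≠ 0) (h1 : lam ≠ 1)
    (h : IsTorsionX lam x) (hx : x ≠ 0) : v lam ≤ max 1 (v lam) * v x := by
  have := (h.translate_zero h0 h1 hx).valuation_le v hv
  rwa [map_div₀, div_le_iff₀ (zero_lt_iff.2 (v.ne_zero_iff.2 hx))] at this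

/-- The bound `valuation_le` for the translate by `(1, 0)`. -/
theorem IsTorsionX.valuation_one_sub_le (hv : v 2 < 1) (h0 : lam ≠ 0) (h1 : lam ≠ 1)
    (h : IsTorsionX lam x) (hx : x ≠ 1) : v (1 - lam) ≤ max 1 (v lam) * v (x - 1) := by
  have := (h.translate_one h0 h1 hx).valuation_le v hv
  rw [map_div₀, div_le_iff₀ (zero_lt_iff.2 (v.ne_zero_iff.2 (sub_ne_zero.2 hx)))] at this
  have e : 1 - lam = (x - lam) - (x - 1) := by ring
  rw [e]
  exact v.map_sub_le this (le_mul_of_one_le_left' (le_max_left _ _))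

/-- The bound `valuation_le` for the translate by `(lam, 0) = (1, 0) + (0, 0)`. -/
theorem IsTorsionX.valuation_param_mul_le (hv : v 2 < 1) (h0 : lam ≠ 0) (h1 : lam ≠ 1)
    (h : IsTorsionX lam x) (hx : x ≠ 1) (hxl : x ≠ lam) :
    v lam * v (x - 1) ≤ max 1 (v lam) * v (x - lam) := by
  have hx' := sub_ne_zero.2 hx
  have hxl' := sub_ne_zero.2 hxl
  have := ((h.translate_one h0 h1 hx).translate_zero h0 h1
    (div_ne_zero hxl' hx')).valuation_le v hv
  rwa [div_div_eq_mul_div, map_div₀, div_le_iff₀ (zero_lt_iff.2 (v.ne_zero_iff.2 hxl')),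
    map_mul] at this

/-- The bound `valuation_le` for the sum and the difference of two torsion points. -/
theorem IsTorsionX.valuation_sq_sub_le (hv : v 2 < 1) (h₁ : IsTorsionX lam x₁)
    (h₂ : IsTorsionX lam x₂) (hx : x₁ ≠ x₂) :
    v (x₁ ^ 2 - lam) ≤ max 1 (v lam) * v (x₁ - x₂) := by
  obtain ⟨s, t, hs, ht, e⟩ := h₁.exists_mul_eq h₂ hx
  have hs := hs.valuation_le v hv
  have ht := ht.valuation_le v hv
  have hx₁ := h₁.valuation_le v hv
  have key : v (x₁ * x₂ - lam) ≤ max 1 (v lam) * v (x₁ - x₂) := by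
    rw [← pow_le_pow_iff_left₀ zero_le zero_le two_ne_zero, ← map_pow, ← e, map_mul, map_mul,
      map_pow, mul_pow, sq (max 1 (v lam))]
    gcongr
  have e : x₁ ^ 2 - lam = (x₁ * x₂ - lam) + x₁ * (x₁ - x₂) := by ring
  rw [e]
  refine v.map_add_le key ?_
  rw [map_mul]
  gcongr

/-- Distinct abscissas of torsion points are uniformly separated in the `2`-adic metric: they are at
least about as far apart as `x₁²` is from `lam`, and this distance is bounded below because the
abscissa `(x₁² - lam)² / (4 x₁ (x₁ - 1) (x₁ - lam))` of the double and the factors of its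
denominator stay away from `0`. -/
theorem IsTorsionX.separation (hv : v 2 < 1) (h0 : lam ≠ 0) (h1 : lam ≠ 1)
    (h₁ : IsTorsionX lam x₁) (h₂ : IsTorsionX lam x₂) (hx : x₁ ≠ x₂)
    (hx0 : x₁ ≠ 0) (hx1 : x₁ ≠ 1) (hxl : x₁ ≠ lam) (hsq : x₁ ^ 2 ≠ lam) :
    v 4 * v lam ^ 3 * v (1 - lam) ^ 2 ≤ max 1 (v lam) ^ 7 * v (x₁ - x₂) ^ 2 := by
  have a1 := h₁.valuation_sq_sub_le v hv h₂ hx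
  have a2 := h₁.valuation_param_le v hv h0 h1 hx0
  have a3 := h₁.valuation_one_sub_le v hv h0 h1 hx1
  have a4 := h₁.valuation_param_mul_le v hv h0 h1 hx1 hxl
  have hx1' := sub_ne_zero.2 hx1
  have hxl' := sub_ne_zero.2 hxl
  have hsq' := sub_ne_zero.2 hsq
  have a5 := (h₁.double hx0 hx1 hxl).valuation_param_le v hv h0 h1
    (div_ne_zero (pow_ne_zero 2 hsq')
      (mul_ne_zero (mul_ne_zero (mul_ne_zero (by norm_num) hx0) hx1') hxl'))
  have e := valuation_double_mul v hx0 hx1 hxl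
  generalize v ((x₁ ^ 2 - lam) ^ 2 / (4 * x₁ * (x₁ - 1) * (x₁ - lam))) = X at *
  generalize max 1 (v lam) = M at *
  calc v 4 * v lam ^ 3 * v (1 - lam) ^ 2
      = v 4 * v lam * v lam * (v lam * v (1 - lam)) * v (1 - lam) := by
        simp only [pow_succ, pow_zero, one_mul]; ac_rfl
    _ ≤ v 4 * (M * X) * (M * v x₁) * (v lam * (M * v (x₁ - 1))) * (M * v (x₁ - 1)) := by gcongr
    _ = v 4 * (M * X) * (M * v x₁) * (M * (v lam * v (x₁ - 1))) * (M * v (x₁ - 1)) := by ac_rfl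
    _ ≤ v 4 * (M * X) * (M * v x₁) * (M * (M * v (x₁ - lam))) * (M * v (x₁ - 1)) := by gcongr
    _ = M ^ 5 * (X * (v 4 * v x₁ * v (x₁ - 1) * v (x₁ - lam))) := by
        simp only [pow_succ, pow_zero, one_mul]; ac_rfl
    _ = M ^ 5 * v (x₁ ^ 2 - lam) ^ 2 := by rw [e]
    _ ≤ M ^ 5 * (M * v (x₁ - x₂)) ^ 2 := by gcongr
    _ = M ^ 7 * v (x₁ - x₂) ^ 2 := by rw [mul_pow, ← mul_assoc, ← pow_add]

end Valuation

/-! ### Reduction modulo `2` -/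

section Reduction

/-- The ring of `2`-adic integers attached to an embedding of `QBar` into `PadicAlgCl 2` extends to
a valuation ring of `ℂ`. -/
theorem exists_valuationSubring (i : QBar →+* PadicAlgCl 2) :
    ∃ V : ValuationSubring ℂ, ∀ x : QBar, (x : ℂ) ∈ V ↔ i x ∈ 𝒪[PadicAlgCl 2] := by
  let A : ValuationSubring QBar := (Valued.v (R := PadicAlgCl 2)).valuationSubring.comap i
  have hA : ∀ x : QBar, x ∈ A ↔ i x ∈ 𝒪[PadicAlgCl 2] := fun x => Iff.rfl
  obtain ⟨V, hV⟩ :=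
    (LocalSubring.map (algebraMap QBar ℂ) A.toLocalSubring).exists_le_valuationSubring
  obtain ⟨hle, hloc⟩ := LocalSubring.le_def.1 hV
  have hmem : ∀ x : QBar, x ∈ A → (x : ℂ) ∈ V := fun x hx => hle ⟨x, hx, rfl⟩
  refine ⟨V, fun x => ⟨fun hx => ?_, fun hx => hmem x ((hA x).2 hx)⟩⟩
  rw [← hA]
  by_contra hxA
  -- `x⁻¹` is then a nonunit of `A`, so it remains a nonunit in the dominating ring `V`.
  have hx0 : x ≠ 0 := fun h => hxA (h ▸ A.zero_mem)
  have hinv : x⁻¹ ∈ A := (A.mem_or_inv_mem x).resolve_left hxA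
  let z : (LocalSubring.map (algebraMap QBar ℂ) A.toLocalSubring).toSubring :=
    ⟨algebraMap QBar ℂ x⁻¹, x⁻¹, hinv, rfl⟩
  have hu : IsUnit (Subring.inclusion hle z) := by
    refine IsUnit.of_mul_eq_one (⟨(x : ℂ), hx⟩ : V.toLocalSubring.toSubring) ?_
    apply Subtype.ext
    have : ((x⁻¹ : QBar) : ℂ) * (x : ℂ) = 1 := by
      have : x⁻¹ * x = 1 := inv_mul_cancel₀ hx0
      exact_mod_cast congrArg (fun t : QBar => (t : ℂ)) this
    exact this
  obtain ⟨w, hw⟩ := (hloc.map_nonunit z hu).exists_right_inv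
  obtain ⟨w', hw'A, hw'⟩ := w.2
  have h1 : algebraMap QBar ℂ (x⁻¹ * w') = algebraMap QBar ℂ 1 := by
    rw [map_mul, map_one]
    have := congrArg Subtype.val hw
    rw [hw']
    exact this
  have h2 : x⁻¹ * w' = 1 := (algebraMap QBar ℂ).injective h1
  have h3 : w' = x := by
    rw [inv_mul_eq_div, div_eq_one_iff_eq hx0] at h2
    exact h2
  exact hxA (h3 ▸ hw'A)

theorem valuation_two_lt_one {i : QBar →+* PadicAlgCl 2} {V : ValuationSubring ℂ}
    (hV : ∀ x : QBar, (x : ℂ) ∈ V ↔ i x ∈ 𝒪[PadicAlgCl 2]) : V.valuation 2 < 1 := by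
  by_contra! h
  have h2 : V.valuation (((2⁻¹ : QBar) : ℂ)) ≤ 1 := by
    have : ((2⁻¹ : QBar) : ℂ) = (2 : ℂ)⁻¹ := by push_cast; rfl
    rw [this, map_inv₀]
    exact inv_le_one_of_one_le₀ h
  rw [V.valuation_le_one_iff, hV, Valuation.mem_integer_iff, map_inv₀, map_inv₀, map_ofNat] at h2
  have h3 := PadicAlgCl.valuation_p 2
  rw [Nat.cast_ofNat] at h3
  rw [h3] at h2
  norm_num at h2

theorem reduction_eq_of_valuation {i : QBar →+* PadicAlgCl 2} {V : ValuationSubring ℂ}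
    (hV : ∀ x : QBar, (x : ℂ) ∈ V ↔ i x ∈ 𝒪[PadicAlgCl 2]) {α β : QBar}
    (hα : V.valuation (α : ℂ) ≤ 1) (hβ : V.valuation (β : ℂ) ≤ 1)
    (h : V.valuation ((α : ℂ) - β) < 1) : reduction i α = reduction i β := by
  have hα' := (hV α).1 ((V.valuation_le_one_iff _).1 hα)
  have hβ' := (hV β).1 ((V.valuation_le_one_iff _).1 hβ)
  rw [reduction, reduction, dif_pos hα', dif_pos hβ']
  congr 1
  rw [← sub_eq_zero, ← map_sub, IsLocalRing.residue_eq_zero_iff, IsLocalRing.mem_maximalIdeal,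
    mem_nonunits_iff]
  intro hu
  obtain ⟨w, hw⟩ := hu.exists_right_inv
  have hw : (i α - i β) * (w : PadicAlgCl 2) = 1 := congrArg Subtype.val hw
  have hne : i α - i β ≠ 0 := left_ne_zero_of_mul_eq_one hw
  have hne' : α - β ≠ 0 := fun h => hne (by rw [← map_sub, h, map_zero])
  -- The inverse of `α - β` is integral, so that `α - β` is a unit of `V`.
  have hinv : (((α - β)⁻¹ : QBar) : ℂ) ∈ V := by
    rw [hV, map_inv₀, map_sub, inv_eq_of_mul_eq_one_right hw]
    exact w.2
  rw [← V.valuation_le_one_iff] at hinv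
  have e : (((α - β)⁻¹ : QBar) : ℂ) = ((α : ℂ) - β)⁻¹ := by push_cast; rfl
  rw [e, map_inv₀] at hinv
  have hpos : 0 < V.valuation ((α : ℂ) - β) := by
    rw [Valuation.pos_iff]
    exact_mod_cast hne'
  exact h.not_ge ((inv_le_one₀ hpos).1 hinv)

theorem reduction_eq_infty {i : QBar →+* PadicAlgCl 2} {V : ValuationSubring ℂ}
    (hV : ∀ x : QBar, (x : ℂ) ∈ V ↔ i x ∈ 𝒪[PadicAlgCl 2]) {α : QBar}
    (hα : 1 < V.valuation (α : ℂ)) : reduction i α = OnePoint.infty := by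
  rw [reduction, dif_neg]
  rw [← hV, ← V.valuation_le_one_iff]
  exact hα.not_ge

/-- If `α ≠ lam` is the abscissa of a torsion point of `E_lam`, then the reduction of `lam` is the
square of that of `α`.  As squaring is injective in characteristic two, `α` and `β` have the same
reduction when both occur for the same `lam`. -/
theorem simultaneousTorsionParams_subset {i : QBar →+* PadicAlgCl 2} {α β : QBar}
    (hα0 : α ≠ 0) (hα1 : α ≠ 1) (hβ0 : β ≠ 0) (hβ1 : β ≠ 1)
    (h : reduction i α ≠ reduction i β) :
    simultaneousTorsionParams (α : ℂ) (β : ℂ) ⊆ {(α : ℂ), (β : ℂ)} := by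
  rintro lam ⟨⟨-, -, hα⟩, -, -, hβ⟩
  change IsTorsionX lam α at hα
  change IsTorsionX lam β at hβ
  by_contra! hlam
  simp only [Set.mem_insert_iff, Set.mem_singleton_iff, not_or] at hlam
  obtain ⟨hlα, hlβ⟩ := hlam
  have hα0 : (α : ℂ) ≠ 0 := by exact_mod_cast hα0
  have hα1 : (α : ℂ) ≠ 1 := by exact_mod_cast hα1
  have hβ0 : (β : ℂ) ≠ 0 := by exact_mod_cast hβ0
  have hβ1 : (β : ℂ) ≠ 1 := by exact_mod_cast hβ1
  obtain ⟨V, hV⟩ := exists_valuationSubring i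
  have h2 := valuation_two_lt_one hV
  apply h
  rcases le_or_gt (V.valuation lam) 1 with hl | hl
  · have vα : V.valuation (α : ℂ) ≤ 1 := by simpa [hl] using hα.valuation_le _ h2
    have vβ : V.valuation (β : ℂ) ≤ 1 := by simpa [hl] using hβ.valuation_le _ h2
    have sα := hα.valuation_sq_sub_lt_one _ h2 hα0 hα1 (Ne.symm hlα) hl
    have sβ := hβ.valuation_sq_sub_lt_one _ h2 hβ0 hβ1 (Ne.symm hlβ) hl
    refine reduction_eq_of_valuation hV vα vβ ?_
    have h2' : V.valuation (2 * β * (β - α)) < 1 := by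
      rw [map_mul, map_mul]
      calc _ ≤ V.valuation 2 * 1 * 1 := by
            gcongr
            exact Valuation.map_sub_le _ vβ vα
        _ < 1 := by simpa using h2
    have e : ((α : ℂ) - β) ^ 2 = ((α : ℂ) ^ 2 - lam) - ((β : ℂ) ^ 2 - lam) + 2 * β * (β - α) := by
      ring
    have hlt : V.valuation ((α : ℂ) - β) ^ 2 < 1 := by
      rw [← map_pow, e]
      exact Valuation.map_add_lt _ (Valuation.map_sub_lt _ sα sβ) h2'
    by_contra! hc
    exact hlt.not_ge (one_le_pow₀ hc)
  · rw [reduction_eq_infty hV (hα.one_lt_valuation _ h2 hα0 hα1 (Ne.symm hlα) hl),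
      reduction_eq_infty hV (hβ.one_lt_valuation _ h2 hβ0 hβ1 (Ne.symm hlβ) hl)]

end Reduction

/-! ### Counting residue classes -/

section Counting

theorem valuation_intCast_le_one (V : ValuationSubring ℂ) (n : ℤ) : V.valuation (n : ℂ) ≤ 1 :=
  (V.valuation_le_one_iff _).2 (intCast_mem V n)

/-- A nonzero integer `n` is divisible by `2` fewer than `|n|` times. -/
theorem valuation_two_pow_natAbs_lt {V : ValuationSubring ℂ} (hv : V.valuation 2 < 1) {n : ℤ}
    (hn : n ≠ 0) : V.valuation 2 ^ n.natAbs < V.valuation (n : ℂ) := by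
  have h2 : 0 < V.valuation 2 := by rw [Valuation.pos_iff]; norm_num
  obtain ⟨e, m, hm, he⟩ := Nat.exists_eq_two_pow_mul_odd (Int.natAbs_ne_zero.2 hn)
  have hodd : V.valuation (m : ℂ) = 1 := by
    obtain ⟨r, rfl⟩ := hm
    have hr : V.valuation (2 * (r : ℂ)) < 1 := by
      have := valuation_intCast_le_one V r
      rw [Int.cast_natCast] at this
      rw [map_mul]
      exact mul_lt_one_of_lt_of_le hv this
    push_cast
    rw [Valuation.map_add_eq_of_lt_right _ (by simpa using hr), map_one]
  have hval : V.valuation (n : ℂ) = V.valuation (n.natAbs : ℂ) := by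
    rcases Int.natAbs_eq n with h | h
    · rw [h]; simp
    · rw [h, Int.cast_neg, Valuation.map_neg]; simp
  rw [hval, he, Nat.cast_mul, map_mul, hodd, mul_one, Nat.cast_pow, Nat.cast_ofNat, map_pow]
  apply pow_lt_pow_right_of_lt_one₀ h2 hv
  have hm0 : 0 < m := hm.pos
  calc e < 2 ^ e := Nat.lt_two_pow_self
    _ ≤ 2 ^ e * m := Nat.le_mul_of_pos_right _ hm0

/-- Among more than `2 ^ (L * t)` elements of a valuation ring that lie in a number field of degree
at most `L` two are congruent modulo `2 ^ t`: the `ℤ`-module `M` which they span is free of rank at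
most `L`, so that `M / 2 ^ t M` has at most `2 ^ (L * t)` elements. -/
theorem exists_congruent (V : ValuationSubring ℂ) (K : IntermediateField ℚ ℂ)
    [FiniteDimensional ℚ K] {L t : ℕ} (hL : Module.finrank ℚ K ≤ L)
    (y : ℕ → ℂ) (hy : ∀ k ≤ 2 ^ (L * t), y k ∈ K ∧ y k ∈ V) :
    ∃ j k, j < k ∧ k ≤ 2 ^ (L * t) ∧ ∃ z ∈ V, y j - y k = 2 ^ t * z := by
  classical
  set N := 2 ^ (L * t) with hN
  let M : Submodule ℤ ℂ := Submodule.span ℤ (y '' Set.Iic N)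
  have hfg : M.FG := Submodule.fg_span ((Set.finite_Iic N).image y)
  have : Module.Finite ℤ M := Module.Finite.iff_fg.2 hfg
  have : Module.Free ℤ M := inferInstance
  let b := Module.Free.chooseBasis ℤ M
  have hMK : ∀ z ∈ M, z ∈ K := by
    have : M ≤ (K.toSubfield.toAddSubgroup).toIntSubmodule := by
      refine Submodule.span_le.2 ?_
      rintro _ ⟨k, hk, rfl⟩
      exact (hy k hk).1
    exact fun z hz => this hz
  have hMV : ∀ z ∈ M, z ∈ V := by
    have : M ≤ (V.toSubring.toAddSubgroup).toIntSubmodule := by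
      refine Submodule.span_le.2 ?_
      rintro _ ⟨k, hk, rfl⟩
      exact (hy k hk).2
    exact fun z hz => this hz
  have hcard : Fintype.card (Module.Free.ChooseBasisIndex ℤ M) ≤ L := by
    have hli : LinearIndependent ℤ fun i => (b i : ℂ) :=
      b.linearIndependent.map' M.subtype (Submodule.ker_subtype M)
    have hli' : LinearIndependent ℤ fun i => (⟨b i, hMK _ (b i).2⟩ : K) :=
      LinearIndependent.of_comp (K.val.toLinearMap.restrictScalars ℤ) hli
    have hliQ := (LinearIndependent.iff_fractionRing ℤ ℚ).1 hli'
    exact hliQ.fintype_card_le_finrank.trans hL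
  -- Reduce the coordinates modulo `2 ^ t` and apply the pigeonhole principle.
  have : NeZero (2 ^ t) := ⟨by positivity⟩
  have hyM : ∀ k ≤ N, y k ∈ M := fun k hk => Submodule.subset_span ⟨k, hk, rfl⟩
  let f : Fin (N + 1) → (Module.Free.ChooseBasisIndex ℤ M → ZMod (2 ^ t)) := fun k i =>
    (b.repr ⟨y k, hyM k (Nat.lt_succ_iff.1 k.2)⟩ i : ZMod (2 ^ t))
  have hlt : Fintype.card (Module.Free.ChooseBasisIndex ℤ M → ZMod (2 ^ t)) <
      Fintype.card (Fin (N + 1)) := by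
    rw [Fintype.card_fun, ZMod.card, Fintype.card_fin, ← pow_mul, Nat.lt_succ_iff, hN]
    apply Nat.pow_le_pow_right two_pos
    rw [mul_comm]
    exact Nat.mul_le_mul_right _ hcard
  obtain ⟨j, k, hjk, hf⟩ := Fintype.exists_ne_map_eq_of_card_lt f hlt
  wlog hlt' : j < k generalizing j k
  · exact this k j hjk.symm hf.symm (lt_of_le_of_ne (not_lt.1 hlt') hjk.symm)
  refine ⟨j, k, hlt', Nat.lt_succ_iff.1 k.2, ?_⟩
  set yj : M := ⟨y j, hyM j (Nat.lt_succ_iff.1 j.2)⟩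
  set yk : M := ⟨y k, hyM k (Nat.lt_succ_iff.1 k.2)⟩
  have hdvd : ∀ i, ∃ c : ℤ, b.repr (yj - yk) i = 2 ^ t * c := by
    intro i
    have h1 : ((b.repr yj i : ℤ) : ZMod (2 ^ t)) = (b.repr yk i : ℤ) := congrFun hf i
    rw [← sub_eq_zero, ← Int.cast_sub, ZMod.intCast_zmod_eq_zero_iff_dvd] at h1
    obtain ⟨c, hc⟩ := h1
    exact ⟨c, by rw [map_sub, Finsupp.sub_apply, hc]; push_cast; rfl⟩
  choose c hc using hdvd
  let z : M := ∑ i, c i • b i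
  have hz : yj - yk = (2 ^ t : ℤ) • z := by
    rw [← b.sum_repr (yj - yk), Finset.smul_sum]
    exact Finset.sum_congr rfl fun i _ => by rw [hc, mul_smul]
  refine ⟨z, hMV _ z.2, ?_⟩
  have := congrArg (fun m : M => (m : ℂ)) hz
  simpa [yj, yk] using this

end Counting

/-- Torsion points whose abscissas lie in a number field of degree at most `L` repeat within an
explicit bound: their abscissas are separated in the `2`-adic metric, and the number field has only
finitely many residue classes at each level. The integers `s` and `q` measure
how far `lam` is from being integral and how close it is to `0` and `1`. -/
theorem exists_eq_of_isTorsionX {V : ValuationSubring ℂ} (hv : V.valuation 2 < 1) {lam : ℂ}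
    (h0 : lam ≠ 0) (h1 : lam ≠ 1) {s q : ℤ} (hs0 : s ≠ 0) (hq0 : q ≠ 0)
    (hs : V.valuation (s * lam) ≤ 1) (hq : V.valuation (q : ℂ) ≤ V.valuation (lam * (1 - lam)))
    (K : IntermediateField ℚ ℂ) [FiniteDimensional ℚ K] {L t : ℕ}
    (hL : Module.finrank ℚ K ≤ L) (ht : t = (4 * q ^ 3 * s ^ 10).natAbs) (x : ℕ → ℂ)
    (hx : ∀ k ≤ 2 ^ (L * t), x k ∈ K ∧ IsTorsionX lam (x k) ∧ x k ≠ 0 ∧ x k ≠ 1 ∧ x k ≠ lam ∧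
      x k ^ 2 ≠ lam) :
    ∃ j k, j < k ∧ k ≤ 2 ^ (L * t) ∧ x j = x k := by
  have hsM : V.valuation (s : ℂ) * max 1 (V.valuation lam) ≤ 1 := by
    rcases max_choice 1 (V.valuation lam) with h | h <;> rw [h]
    · simp [valuation_intCast_le_one V s]
    · rwa [← map_mul]
  obtain ⟨j, k, hjk, hk, z, hz, e⟩ := exists_congruent V K (t := t) hL (fun k => s * x k)
    fun k hk => by
      obtain ⟨hK, hT, -⟩ := hx k hk
      refine ⟨mul_mem (intCast_mem K s) hK, ?_⟩
      rw [← V.valuation_le_one_iff, map_mul]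
      exact le_trans (by gcongr; exact hT.valuation_le _ hv) hsM
  refine ⟨j, k, hjk, hk, ?_⟩
  by_contra hne
  obtain ⟨-, hTj, hj0, hj1, hjl, hjs⟩ := hx j (hjk.le.trans hk)
  obtain ⟨-, hTk, -⟩ := hx k hk
  have sep := hTj.separation V.valuation hv h0 h1 hTk hne hj0 hj1 hjl hjs
  have hw : V.valuation (s : ℂ) * V.valuation (x j - x k) ≤ V.valuation 2 ^ t := by
    have : (s : ℂ) * (x j - x k) = 2 ^ t * z := by rw [← e]; ring
    rw [← map_mul, this, map_mul, map_pow]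
    exact mul_le_of_le_one_right' ((V.valuation_le_one_iff _).2 hz)
  -- If the abscissas differ, then separation makes `4 q³ s¹⁰` divisible by `2 ^ t`, where `t` is
  -- its absolute value.
  have hz0 : 4 * q ^ 3 * s ^ 10 ≠ 0 := by positivity
  have hlt := valuation_two_pow_natAbs_lt hv hz0
  rw [← ht] at hlt
  have hb : V.valuation (1 - lam) ≤ max 1 (V.valuation lam) := by
    simpa using V.valuation.map_sub 1 lam
  push_cast at hlt
  simp only [map_mul, map_pow] at hlt hq
  refine hlt.not_ge ?_
  generalize V.valuation (1 - lam) = b at *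
  generalize V.valuation (x j - x k) = w at *
  generalize V.valuation (s : ℂ) = S at *
  generalize max 1 (V.valuation lam) = M at *
  generalize V.valuation lam = a at *
  generalize V.valuation (q : ℂ) = Q at *
  calc V.valuation 4 * Q ^ 3 * S ^ 10 ≤ V.valuation 4 * (a * b) ^ 3 * S ^ 10 := by gcongr
    _ = (V.valuation 4 * a ^ 3 * b ^ 2) * b * S ^ 10 := by
        simp only [pow_succ, pow_zero, one_mul]; ac_rfl
    _ ≤ (M ^ 7 * w ^ 2) * M * S ^ 10 := by gcongr
    _ = (S * M) ^ 8 * (S * w) ^ 2 := by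
        simp only [pow_succ, pow_zero, one_mul]; ac_rfl
    _ ≤ 1 ^ 8 * (V.valuation 2 ^ t) ^ 2 := by gcongr
    _ = V.valuation 2 ^ t * V.valuation 2 ^ t := by rw [one_pow, one_mul, sq]
    _ ≤ V.valuation 2 ^ t := mul_le_of_le_one_right' (pow_le_one' hv.le t)

/-! ### Computable integer and polynomial arithmetic -/

section PrimrecInt

theorem Int.encode_ofNat (n : ℕ) : Encodable.encode (n : ℤ) = 2 * n := rfl

theorem Int.encode_negSucc (n : ℕ) : Encodable.encode (Int.negSucc n) = 2 * n + 1 := rfl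

theorem Primrec.nat_pow : Primrec₂ ((· ^ ·) : ℕ → ℕ → ℕ) :=
  Primrec₂.unpaired'.1 Nat.Primrec.pow

/-- As `n` and `-(n + 1)` are encoded by `2 * n` and `2 * n + 1`, the parts of an integer are
computed from its code by arithmetic of natural numbers. -/
theorem Primrec.int_toNat : Primrec Int.toNat := by
  have h : Primrec fun x : ℤ =>
      if Encodable.encode x % 2 = 0 then Encodable.encode x / 2 else 0 :=
    Primrec.ite (Primrec.eq.comp (Primrec.nat_mod.comp .encode (.const 2)) (.const 0))
      (Primrec.nat_div.comp .encode (.const 2)) (.const 0)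
  refine h.of_eq fun x => ?_
  rcases x with n | n
  · simp [Int.encode_ofNat]
  · simp [Int.encode_negSucc, Nat.add_mod]

theorem Primrec.int_neg_toNat : Primrec fun x : ℤ => (-x).toNat := by
  have h : Primrec fun x : ℤ =>
      if Encodable.encode x % 2 = 0 then 0 else (Encodable.encode x + 1) / 2 :=
    Primrec.ite (Primrec.eq.comp (Primrec.nat_mod.comp .encode (.const 2)) (.const 0))
      (.const 0)
      (Primrec.nat_div.comp (Primrec.succ.comp .encode) (.const 2))
  refine h.of_eq fun x => ?_
  rcases x with n | n
  · simp [Int.encode_ofNat]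
  · have : (2 * n + 1 + 1) / 2 = n + 1 := by omega
    simp [Int.encode_negSucc, Nat.add_mod, this]

theorem Primrec.int_sub_nat : Primrec₂ fun a b : ℕ => (a : ℤ) - b := by
  have h : Primrec₂ fun a b : ℕ => if b ≤ a then 2 * (a - b) else 2 * (b - a) - 1 := by
    refine Primrec.ite (Primrec.nat_le.comp .snd .fst) ?_ ?_
    · exact Primrec.nat_mul.comp (.const 2) (Primrec.nat_sub.comp .fst .snd)
    · exact Primrec.nat_sub.comp
        (Primrec.nat_mul.comp (.const 2) (Primrec.nat_sub.comp .snd .fst)) (.const 1)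
  refine Primrec.encode_iff.1 (Primrec.of_eq h fun ⟨a, b⟩ => ?_)
  dsimp only
  split_ifs with hab
  · rw [← Int.encode_ofNat, Nat.cast_sub hab]
  · obtain ⟨k, rfl⟩ := Nat.exists_eq_add_of_lt (not_le.1 hab)
    have : (a : ℤ) - ((a + k + 1 : ℕ) : ℤ) = Int.negSucc k := by
      rw [Int.negSucc_eq]; push_cast; ring
    rw [this, Int.encode_negSucc]
    omega

theorem Primrec.int_ofNat : Primrec fun a : ℕ => (a : ℤ) :=
  (Primrec.int_sub_nat.comp .id (.const 0)).of_eq fun a => by simp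

theorem Primrec.int_natAbs : Primrec Int.natAbs :=
  (Primrec.nat_add.comp Primrec.int_toNat Primrec.int_neg_toNat).of_eq fun x => by omega

theorem Primrec.int_add : Primrec₂ ((· + ·) : ℤ → ℤ → ℤ) := by
  have h : Primrec₂ fun x y : ℤ =>
      ((x.toNat + y.toNat : ℕ) : ℤ) - (((-x).toNat + (-y).toNat : ℕ) : ℤ) :=
    Primrec.int_sub_nat.comp
      (Primrec.nat_add.comp (Primrec.int_toNat.comp .fst) (Primrec.int_toNat.comp .snd))
      (Primrec.nat_add.comp (Primrec.int_neg_toNat.comp .fst) (Primrec.int_neg_toNat.comp .snd))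
  exact h.of_eq fun x y => by omega

theorem Primrec.int_mul : Primrec₂ ((· * ·) : ℤ → ℤ → ℤ) := by
  have h : Primrec₂ fun x y : ℤ =>
      ((x.toNat * y.toNat + (-x).toNat * (-y).toNat : ℕ) : ℤ) -
        ((x.toNat * (-y).toNat + (-x).toNat * y.toNat : ℕ) : ℤ) := by
    have a : Primrec fun p : ℤ × ℤ => p.1.toNat := Primrec.int_toNat.comp .fst
    have b : Primrec fun p : ℤ × ℤ => p.2.toNat := Primrec.int_toNat.comp .snd
    have c : Primrec fun p : ℤ × ℤ => (-p.1).toNat := Primrec.int_neg_toNat.comp .fst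
    have d : Primrec fun p : ℤ × ℤ => (-p.2).toNat := Primrec.int_neg_toNat.comp .snd
    exact Primrec.int_sub_nat.comp
      (Primrec.nat_add.comp (Primrec.nat_mul.comp a b) (Primrec.nat_mul.comp c d))
      (Primrec.nat_add.comp (Primrec.nat_mul.comp a d) (Primrec.nat_mul.comp c b))
  refine h.of_eq fun x y => ?_
  have hx : x = (x.toNat : ℤ) - ((-x).toNat : ℤ) := by omega
  have hy : y = (y.toNat : ℤ) - ((-y).toNat : ℤ) := by omega
  conv_rhs => rw [hx, hy]
  push_cast
  ring

end PrimrecInt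

section PolynomialLists

theorem coeff_polyOfList (l : List ℤ) (k : ℕ) : (polyOfList l).coeff k = l.getD k 0 := by
  induction l generalizing k with
  | nil => simp [polyOfList]
  | cons c l ih =>
    cases k with
    | zero => simp [polyOfList]
    | succ k =>
      rw [polyOfList, List.getD_cons_succ, coeff_add, coeff_C_succ, coeff_X_mul, ih, zero_add]

theorem exists_polyOfList_eq (P : ℤ[X]) : ∃ l, polyOfList l = P := by
  refine ⟨(List.range (P.natDegree + 1)).map P.coeff, ?_⟩
  ext k
  rw [coeff_polyOfList]
  rcases lt_or_ge k (P.natDegree + 1) with h | h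
  · simp [h]
  · rw [List.getD_eq_default _ _ (by simpa using h), coeff_eq_zero_of_natDegree_lt (by omega)]

theorem natDegree_polyOfList_le (l : List ℤ) : (polyOfList l).natDegree ≤ l.length := by
  rw [natDegree_le_iff_coeff_eq_zero]
  intro k hk
  rw [coeff_polyOfList, List.getD_eq_default _ _ hk.le]

/-- Addition of polynomials given by coefficient lists. -/
def listAdd (p q : List ℤ) : List ℤ :=
  (List.range (p.length + q.length)).map fun k => p.getD k 0 + q.getD k 0

/-- Multiplication of polynomials given by coefficient lists. -/
def listMul (p q : List ℤ) : List ℤ :=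
  p.foldr (fun c acc => listAdd (q.map (c * ·)) (0 :: acc)) []

/-- Subtraction of polynomials given by coefficient lists. -/
def listSub (p q : List ℤ) : List ℤ := listAdd p (listMul [-1] q)

/-- The product of a list of polynomials given by coefficient lists. -/
def listProd (L : List (List ℤ)) : List ℤ := L.foldr listMul [1]

@[simp]
theorem polyOfList_singleton (c : ℤ) : polyOfList [c] = C c := by simp [polyOfList]

@[simp]
theorem polyOfList_listAdd (p q : List ℤ) :
    polyOfList (listAdd p q) = polyOfList p + polyOfList q := by
  ext k
  rw [coeff_add, coeff_polyOfList, coeff_polyOfList, coeff_polyOfList, listAdd]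
  rcases lt_or_ge k (p.length + q.length) with h | h
  · simp [h]
  · rw [List.getD_eq_default _ _ (by simpa using h), List.getD_eq_default _ _ (by omega),
      List.getD_eq_default _ _ (by omega), add_zero]

theorem polyOfList_map_mul (c : ℤ) (q : List ℤ) :
    polyOfList (q.map (c * ·)) = C c * polyOfList q := by
  induction q with
  | nil => simp [polyOfList]
  | cons d q ih => rw [List.map_cons, polyOfList, polyOfList, ih, C_mul]; ring

@[simp]
theorem polyOfList_listMul (p q : List ℤ) :
    polyOfList (listMul p q) = polyOfList p * polyOfList q := by
  induction p with
  | nil => simp [listMul, polyOfList]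
  | cons c p ih =>
    rw [listMul, List.foldr_cons, polyOfList_listAdd, polyOfList_map_mul, polyOfList,
      ← listMul, ih, polyOfList, C_0]
    ring

@[simp]
theorem polyOfList_listSub (p q : List ℤ) :
    polyOfList (listSub p q) = polyOfList p - polyOfList q := by
  simp [listSub, sub_eq_add_neg]

@[simp]
theorem polyOfList_listProd (L : List (List ℤ)) :
    polyOfList (listProd L) = (L.map polyOfList).prod := by
  induction L with
  | nil => simp [listProd]
  | cons p L ih => rw [listProd, List.foldr_cons, polyOfList_listMul, ← listProd, ih]; simp

theorem polyOfList_eq_zero_iff (l : List ℤ) : polyOfList l = 0 ↔ ∀ c ∈ l, c = 0 := by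
  induction l with
  | nil => simp [polyOfList]
  | cons c l ih =>
    rw [List.forall_mem_cons, ← ih, polyOfList]
    refine ⟨fun h => ?_, fun ⟨h, h'⟩ => by simp [h, h']⟩
    have hc : c = 0 := by simpa using congrArg (fun P => coeff P 0) h
    refine ⟨hc, ?_⟩
    subst hc
    simpa using h

theorem primrec_listAdd : Primrec₂ listAdd := by
  refine Primrec.list_map (Primrec.list_range.comp (Primrec.nat_add.comp
    (Primrec.list_length.comp .fst) (Primrec.list_length.comp .snd))) ?_
  exact Primrec.int_add.comp
    ((Primrec.list_getD 0).comp (Primrec.fst.comp .fst) .snd)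
    ((Primrec.list_getD 0).comp (Primrec.snd.comp .fst) .snd)

theorem primrec_listMul : Primrec₂ listMul := by
  refine Primrec.list_foldr (h := fun (a : List ℤ × List ℤ) (b : ℤ × List ℤ) =>
    listAdd (a.2.map (b.1 * ·)) (0 :: b.2)) .fst (.const []) ?_
  refine primrec_listAdd.comp (Primrec.list_map (Primrec.snd.comp .fst) ?_)
    (Primrec.list_cons.comp (.const 0) (Primrec.snd.comp .snd))
  exact Primrec.int_mul.comp (Primrec.fst.comp (Primrec.snd.comp .fst)) .snd

theorem primrec_listSub : Primrec₂ listSub :=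
  primrec_listAdd.comp .fst (primrec_listMul.comp (.const [-1]) .snd)

theorem primrec_listProd : Primrec listProd :=
  Primrec.list_foldr (h := fun (_ : List (List ℤ)) (b : List ℤ × List ℤ) => listMul b.1 b.2)
    .id (.const [1]) (primrec_listMul.comp (Primrec.fst.comp .snd) (Primrec.snd.comp .snd))

theorem primrecPred_polyOfList_eq_zero : PrimrecPred fun l : List ℤ => polyOfList l = 0 :=
  (PrimrecPred.forall_mem_list (p := fun c : ℤ => c = 0)
    (Primrec.eq.comp .id (.const 0))).of_eq fun l => (polyOfList_eq_zero_iff l).symm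

end PolynomialLists

/-! ### Iterated duplication -/

section Duplication

variable {R : Type*} [CommRing R]

/-- The duplication map on abscissas of `E_lam` with `lam = a / d`, in homogeneous coordinates. -/
def doubleStep (a d : R) (p : R × R) : R × R :=
  ((d * p.1 ^ 2 - a * p.2 ^ 2) ^ 2,
    4 * d * p.1 * p.2 * (p.1 - p.2) * (d * p.1 - a * p.2))

/-- The abscissas of the points `2 ^ k • P`, in homogeneous coordinates. -/
def doubleOrbit (a d : R) (p : R × R) (k : ℕ) : R × R := (doubleStep a d)^[k] p

theorem doubleOrbit_succ (a d : R) (p : R × R) (k : ℕ) :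
    doubleOrbit a d p (k + 1) = doubleStep a d (doubleOrbit a d p k) :=
  Function.iterate_succ_apply' _ _ _

/-- An expression that vanishes if and only if one of the points `x 0, …, x N` of the projective
line is `∞` or two of them coincide. -/
def collisionProd (x : ℕ → R × R) (N : ℕ) : R :=
  ((List.range (N + 1)).map fun k =>
    (x k).2 * ((List.range k).map fun j => (x j).1 * (x k).2 - (x k).1 * (x j).2).prod).prod

theorem collisionProd_eq_zero_iff [IsDomain R] (x : ℕ → R × R) (N : ℕ) :
    collisionProd x N = 0 ↔
      ∃ k ≤ N, (x k).2 = 0 ∨ ∃ j < k, (x j).1 * (x k).2 = (x k).1 * (x j).2 := by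
  simp only [collisionProd, List.prod_eq_zero_iff, List.mem_map, List.mem_range, mul_eq_zero,
    sub_eq_zero, Nat.lt_succ_iff]

end Duplication

section DuplicationOnCurve

open WeierstrassCurve.Affine legendreCurve

variable {lam a d x y : ℂ} {p : ℂ × ℂ}

theorem doubleOrbit_spec (h0 : lam ≠ 0) (h1 : lam ≠ 1) (hd : d ≠ 0) (hlam : lam = a / d)
    (P : (legendreCurve lam).Nonsingular x y) (hp : p.2 ≠ 0) (hx : x = p.1 / p.2) (k : ℕ) :
    ((doubleOrbit a d p k).2 ≠ 0 ∧
      ∃ Y, ∃ H : (legendreCurve lam).Nonsingular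
        ((doubleOrbit a d p k).1 / (doubleOrbit a d p k).2) Y,
        2 ^ k • Point.some x y P = Point.some _ Y H) ∨
    ((doubleOrbit a d p k).2 = 0 ∧ (doubleOrbit a d p k).1 ≠ 0 ∧
      2 ^ k • Point.some x y P = 0) := by
  have ha : a = lam * d := by rw [hlam]; field_simp
  subst ha
  clear hlam
  induction k with
  | zero =>
    subst hx
    exact Or.inl ⟨hp, y, P, by rw [pow_zero, one_smul]; rfl⟩
  | succ k ih =>
    rw [doubleOrbit_succ, pow_succ', mul_smul, two_smul]
    generalize doubleOrbit (lam * d) d p k = q at *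
    obtain ⟨u, w⟩ := q
    simp only [doubleStep]
    dsimp only at ih
    rcases ih with ⟨hw, Y, H, e⟩ | ⟨hw, hu, e⟩
    · rw [e]
      by_cases hY : Y = 0
      · refine Or.inr ⟨?_, ?_, add_self_eq_zero H hY⟩
        · rcases (y_eq_zero_iff H).1 hY with h | h | h
          · rw [div_eq_zero_iff, or_iff_left hw] at h
            subst h; ring
          · rw [div_eq_one_iff_eq hw] at h
            subst h; ring
          · rw [div_eq_iff hw] at h
            subst h; ring
        · apply pow_ne_zero
          rcases (y_eq_zero_iff H).1 hY with h | h | h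
          · rw [div_eq_zero_iff, or_iff_left hw] at h
            subst h
            simpa using ⟨⟨h0, hd⟩, hw⟩
          · rw [div_eq_one_iff_eq hw] at h
            subst h
            have : d * u ^ 2 - lam * d * u ^ 2 = d * u ^ 2 * (1 - lam) := by ring
            rw [this]
            exact mul_ne_zero (mul_ne_zero hd (pow_ne_zero 2 hw)) (sub_ne_zero.2 h1.symm)
          · rw [div_eq_iff hw] at h
            subst h
            have : d * (lam * w) ^ 2 - lam * d * w ^ 2 = d * lam * w ^ 2 * (lam - 1) := by ring
            rw [this]
            exact mul_ne_zero (mul_ne_zero (mul_ne_zero hd h0) (pow_ne_zero 2 hw))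
              (sub_ne_zero.2 h1)
      · left
        have hY' := mt (y_eq_zero_iff H).2 hY
        rw [not_or, not_or, div_eq_iff hw, div_eq_iff hw, div_eq_iff hw, zero_mul, one_mul] at hY'
        obtain ⟨hu, hu1, hul⟩ := hY'
        have hu1' := sub_ne_zero.2 hu1
        have hul' := sub_ne_zero.2 hul
        have e1 : d * u - lam * d * w = d * (u - lam * w) := by ring
        have e2 : d * u ^ 2 - lam * d * w ^ 2 = d * (u ^ 2 - lam * w ^ 2) := by ring
        have e3 : u / w - 1 = (u - w) / w := by field_simp
        have e4 : u / w - lam = (u - lam * w) / w := by field_simp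
        have e5 : (u / w) ^ 2 - lam = (u ^ 2 - lam * w ^ 2) / w ^ 2 := by field_simp
        have hX : ((u / w) ^ 2 - lam) ^ 2 / (4 * (u / w) * (u / w - 1) * (u / w - lam)) =
            (d * u ^ 2 - lam * d * w ^ 2) ^ 2 /
              (4 * d * u * w * (u - w) * (d * u - lam * d * w)) := by
          rw [e1, e2, e3, e4, e5]
          field_simp
        obtain ⟨Y', H', e'⟩ := exists_add_self_eq_some H hY
        refine ⟨?_, Y', hX ▸ H', by rw [e']; simp only [hX]⟩
        rw [e1]
        simp only [ne_eq, mul_eq_zero, not_or]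
        exact ⟨⟨⟨⟨⟨by norm_num, hd⟩, hu⟩, hw⟩, hu1'⟩, hd, hul'⟩
    · right
      subst hw
      refine ⟨by ring, ?_, by rw [e, add_zero]⟩
      simpa using ⟨hd, hu⟩

/-- A coincidence among the points `2 ^ k • P` makes `P` torsion. -/
theorem isOfFinAddOrder_of_collisionProd_eq_zero (h0 : lam ≠ 0) (h1 : lam ≠ 1) (hd : d ≠ 0)
    (hlam : lam = a / d) (P : (legendreCurve lam).Nonsingular x y) (hp : p.2 ≠ 0)
    (hx : x = p.1 / p.2) {N : ℕ} (hN : collisionProd (doubleOrbit a d p) N = 0) :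
    IsOfFinAddOrder (Point.some x y P) := by
  have spec := doubleOrbit_spec h0 h1 hd hlam P hp hx
  have hzero : ∀ k, (doubleOrbit a d p k).2 = 0 → IsOfFinAddOrder (Point.some x y P) := by
    intro k hk
    obtain ⟨h, -⟩ | ⟨-, -, e⟩ := spec k
    · exact absurd hk h
    · exact isOfFinAddOrder_iff_nsmul_eq_zero.2 ⟨2 ^ k, by positivity, e⟩
  obtain ⟨k, -, h | ⟨j, hjk, h⟩⟩ := (collisionProd_eq_zero_iff _ _).1 hN
  · exact hzero k h
  obtain ⟨hk, Yk, Hk, ek⟩ | ⟨hk, -⟩ := spec k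
  swap
  · exact hzero k hk
  obtain ⟨hj, Yj, Hj, ej⟩ | ⟨hj, -⟩ := spec j
  swap
  · exact hzero j hj
  have hX : (doubleOrbit a d p j).1 / (doubleOrbit a d p j).2 =
      (doubleOrbit a d p k).1 / (doubleOrbit a d p k).2 := by
    rw [div_eq_div_iff hj hk, h]
  have hlt : 2 ^ j < 2 ^ k := Nat.pow_lt_pow_right one_lt_two hjk
  rw [isOfFinAddOrder_iff_nsmul_eq_zero]
  rcases Point.X_eq_iff (h₁ := Hj) (h₂ := Hk) |>.1 hX with h | h
  · refine ⟨2 ^ k - 2 ^ j, Nat.sub_pos_of_lt hlt, ?_⟩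
    rw [sub_nsmul _ hlt.le, ek, ej, h, add_neg_cancel]
  · refine ⟨2 ^ k + 2 ^ j, by positivity, ?_⟩
    rw [add_nsmul, ek, ej, h, add_neg_cancel]

/-- If `P` is torsion, then a coincidence among the points `2 ^ k • P` occurs within the bound
of `exists_eq_of_isTorsionX`. -/
theorem collisionProd_eq_zero_of_isOfFinAddOrder {V : ValuationSubring ℂ}
    (hv : V.valuation 2 < 1) (h0 : lam ≠ 0) (h1 : lam ≠ 1) (hd : d ≠ 0) (hlam : lam = a / d)
    {s q : ℤ} (hs0 : s ≠ 0) (hq0 : q ≠ 0) (hs : V.valuation (s * lam) ≤ 1)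
    (hq : V.valuation (q : ℂ) ≤ V.valuation (lam * (1 - lam)))
    (K : IntermediateField ℚ ℂ) [FiniteDimensional ℚ K] {L t : ℕ}
    (hL : Module.finrank ℚ K ≤ L) (ht : t = (4 * q ^ 3 * s ^ 10).natAbs)
    (haK : a ∈ K) (hdK : d ∈ K) (hpK : p.1 ∈ K ∧ p.2 ∈ K)
    (P : (legendreCurve lam).Nonsingular x y) (hp : p.2 ≠ 0)
    (hx : x = p.1 / p.2) (hP : IsOfFinAddOrder (Point.some x y P)) :
    collisionProd (doubleOrbit a d p) (2 ^ (L * t) + 2) = 0 := by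
  have spec := doubleOrbit_spec h0 h1 hd hlam P hp hx
  by_contra hN
  rw [collisionProd_eq_zero_iff] at hN
  push Not at hN
  have horb : ∀ k, (doubleOrbit a d p k).1 ∈ K ∧ (doubleOrbit a d p k).2 ∈ K := by
    intro k
    induction k with
    | zero => exact hpK
    | succ k ih =>
      obtain ⟨hu, hw⟩ := ih
      rw [doubleOrbit_succ]
      have h4 : (4 : ℂ) ∈ K := ofNat_mem K 4
      exact ⟨pow_mem (sub_mem (mul_mem hdK (pow_mem hu 2)) (mul_mem haK (pow_mem hw 2))) 2,
        mul_mem (mul_mem (mul_mem (mul_mem (mul_mem h4 hdK) hu) hw) (sub_mem hu hw))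
          (sub_mem (mul_mem hdK hu) (mul_mem haK hw))⟩
  have ha : a = lam * d := by rw [hlam]; field_simp
  -- Neither the double nor the quadruple of a counted point is zero, so its abscissa is none of
  -- `0`, `1`, `lam`, and its square is not `lam`.
  obtain ⟨j, k, hjk, hk, e⟩ := exists_eq_of_isTorsionX hv h0 h1 hs0 hq0 hs hq K hL ht
    (fun k => (doubleOrbit a d p k).1 / (doubleOrbit a d p k).2) fun k hk => by
      have hk0 := (hN k (by omega)).1
      have hk1 := (hN (k + 1) (by omega)).1
      have hk2 := (hN (k + 2) (by omega)).1
      refine ⟨div_mem (horb k).1 (horb k).2, ?_⟩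
      obtain ⟨-, Y, H, e⟩ | ⟨h, -⟩ := spec k
      swap
      · exact absurd h hk0
      rw [doubleOrbit_succ, doubleOrbit_succ] at hk2
      rw [doubleOrbit_succ] at hk1
      refine ⟨⟨Y, H, e ▸ hP.nsmul⟩, ?_⟩
      generalize doubleOrbit a d p k = r at *
      obtain ⟨u, w⟩ := r
      simp only [doubleStep, ha] at hk0 hk1 hk2
      refine ⟨fun h => ?_, fun h => ?_, fun h => ?_, fun h => ?_⟩ <;> dsimp only at h
      · rw [div_eq_zero_iff, or_iff_left hk0] at h
        apply hk1; rw [h]; ring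
      · rw [div_eq_one_iff_eq hk0] at h
        apply hk1; rw [h]; ring
      · rw [div_eq_iff hk0] at h
        apply hk1; rw [h]; ring
      · rw [div_pow, div_eq_iff (pow_ne_zero 2 hk0)] at h
        apply hk2; rw [h]; ring
  have := (hN k (by omega)).2 j hjk
  exact this ((div_eq_div_iff (hN j (by omega)).1 (hN k (by omega)).1).1 e)

end DuplicationOnCurve

/-! ### Duplication on coefficient lists, and search -/

section ListDuplication

/-- `doubleStep` on coefficient lists. -/
def listDoubleStep (A D : List ℤ) (p : List ℤ × List ℤ) : List ℤ × List ℤ :=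
  (listMul (listSub (listMul D (listMul p.1 p.1)) (listMul A (listMul p.2 p.2)))
      (listSub (listMul D (listMul p.1 p.1)) (listMul A (listMul p.2 p.2))),
    listMul (listMul (listMul (listMul (listMul [4] D) p.1) p.2) (listSub p.1 p.2))
      (listSub (listMul D p.1) (listMul A p.2)))

/-- `doubleOrbit` on coefficient lists. -/
def listDoubleOrbit (A D : List ℤ) (p : List ℤ × List ℤ) (k : ℕ) : List ℤ × List ℤ :=
  (listDoubleStep A D)^[k] p

/-- `collisionProd` on coefficient lists. -/
def listCollisionProd (A D : List ℤ) (p : List ℤ × List ℤ) (N : ℕ) : List ℤ :=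
  listProd ((List.range (N + 1)).map fun k =>
    listMul (listDoubleOrbit A D p k).2 (listProd ((List.range k).map fun j =>
      listSub (listMul (listDoubleOrbit A D p j).1 (listDoubleOrbit A D p k).2)
        (listMul (listDoubleOrbit A D p k).1 (listDoubleOrbit A D p j).2))))

theorem map_polyOfList_listDoubleOrbit (A D : List ℤ) (p : List ℤ × List ℤ) (k : ℕ) :
    Prod.map polyOfList polyOfList (listDoubleOrbit A D p k) =
      doubleOrbit (polyOfList A) (polyOfList D) (Prod.map polyOfList polyOfList p) k := by
  induction k with
  | zero => rfl
  | succ k ih =>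
    rw [doubleOrbit_succ, ← ih, listDoubleOrbit, Function.iterate_succ_apply', ← listDoubleOrbit]
    simp only [listDoubleStep, doubleStep, Prod.map_apply',
      polyOfList_listMul, polyOfList_listSub, polyOfList_singleton]
    ext1
    · simp only; ring
    · simp only [eq_intCast, Int.cast_ofNat]

theorem polyOfList_listCollisionProd (A D : List ℤ) (p : List ℤ × List ℤ) (N : ℕ) :
    polyOfList (listCollisionProd A D p N) =
      collisionProd (doubleOrbit (polyOfList A) (polyOfList D)
        (Prod.map polyOfList polyOfList p)) N := by
  simp only [listCollisionProd, collisionProd, polyOfList_listProd, List.map_map,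
    Function.comp_def, polyOfList_listMul, polyOfList_listSub, ← map_polyOfList_listDoubleOrbit,
    Prod.map_fst, Prod.map_snd]

theorem map_doubleOrbit {R S : Type*} [CommRing R] [CommRing S] (f : R →+* S) (a d : R)
    (p : R × R) (k : ℕ) :
    Prod.map f f (doubleOrbit a d p k) = doubleOrbit (f a) (f d) (Prod.map f f p) k := by
  induction k with
  | zero => rfl
  | succ k ih =>
    rw [doubleOrbit_succ, doubleOrbit_succ, ← ih]
    have h4 : f 4 = 4 := map_ofNat f 4
    simp [doubleStep, h4]

theorem map_collisionProd {R S : Type*} [CommRing R] [CommRing S] (f : R →+* S) (x : ℕ → R × R)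
    (N : ℕ) : f (collisionProd x N) = collisionProd (fun k => Prod.map f f (x k)) N := by
  simp [collisionProd, map_list_prod, Function.comp_def]

section

-- Unfolding the list arithmetic would make unification blow up.
attribute [local irreducible] listMul listSub listProd

theorem primrec_listDoubleStep {α : Type*} [Primcodable α] {A D : α → List ℤ}
    {p : α → List ℤ × List ℤ} (hA : Primrec A) (hD : Primrec D) (hp : Primrec p) :
    Primrec fun a => listDoubleStep (A a) (D a) (p a) := by
  have M {f g : α → List ℤ} (hf : Primrec f) (hg : Primrec g) :
      Primrec fun a => listMul (f a) (g a) := primrec_listMul.comp hf hg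
  have S {f g : α → List ℤ} (hf : Primrec f) (hg : Primrec g) :
      Primrec fun a => listSub (f a) (g a) := primrec_listSub.comp hf hg
  have hU : Primrec fun a => (p a).1 := Primrec.fst.comp hp
  have hW : Primrec fun a => (p a).2 := Primrec.snd.comp hp
  have hz := S (M hD (M hU hU)) (M hA (M hW hW))
  unfold listDoubleStep
  exact (M hz hz).pair (M (M (M (M (M (.const [4]) hD) hU) hW) (S hU hW))
    (S (M hD hU) (M hA hW)))

theorem primrec_listDoubleOrbit {α : Type*} [Primcodable α] {A D : α → List ℤ}
    {p : α → List ℤ × List ℤ} {k : α → ℕ} (hA : Primrec A) (hD : Primrec D) (hp : Primrec p)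
    (hk : Primrec k) : Primrec fun a => listDoubleOrbit (A a) (D a) (p a) (k a) := by
  unfold listDoubleOrbit
  exact Primrec.nat_iterate hk hp
    (primrec_listDoubleStep (hA.comp .fst) (hD.comp .fst) .snd).to₂

theorem primrec_listCollisionProd {α : Type*} [Primcodable α] {A D : α → List ℤ}
    {p : α → List ℤ × List ℤ} {N : α → ℕ} (hA : Primrec A) (hD : Primrec D) (hp : Primrec p)
    (hN : Primrec N) : Primrec fun a => listCollisionProd (A a) (D a) (p a) (N a) := by
  have M {β : Type _} [Primcodable β] {f g : β → List ℤ} (hf : Primrec f) (hg : Primrec g) :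
      Primrec fun a => listMul (f a) (g a) := primrec_listMul.comp hf hg
  have hk : Primrec fun b : α × ℕ => listDoubleOrbit (A b.1) (D b.1) (p b.1) b.2 :=
    primrec_listDoubleOrbit (hA.comp .fst) (hD.comp .fst) (hp.comp .fst) .snd
  have hj : Primrec fun b : (α × ℕ) × ℕ =>
      listDoubleOrbit (A b.1.1) (D b.1.1) (p b.1.1) b.2 :=
    hk.comp ((Primrec.fst.comp .fst).pair .snd)
  have hk' : Primrec fun b : (α × ℕ) × ℕ =>
      listDoubleOrbit (A b.1.1) (D b.1.1) (p b.1.1) b.1.2 := hk.comp .fst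
  have hdiff : Primrec fun b : (α × ℕ) × ℕ =>
      listSub (listMul (listDoubleOrbit (A b.1.1) (D b.1.1) (p b.1.1) b.2).1
          (listDoubleOrbit (A b.1.1) (D b.1.1) (p b.1.1) b.1.2).2)
        (listMul (listDoubleOrbit (A b.1.1) (D b.1.1) (p b.1.1) b.1.2).1
          (listDoubleOrbit (A b.1.1) (D b.1.1) (p b.1.1) b.2).2) :=
    primrec_listSub.comp (M (Primrec.fst.comp hj) (Primrec.snd.comp hk'))
      (M (Primrec.fst.comp hk') (Primrec.snd.comp hj))
  have hfactor := M (Primrec.snd.comp hk) (primrec_listProd.comp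
    (Primrec.list_map (Primrec.list_range.comp .snd) hdiff.to₂))
  unfold listCollisionProd
  exact primrec_listProd.comp
    (Primrec.list_map (Primrec.list_range.comp (Primrec.succ.comp hN)) hfactor.to₂)

end

end ListDuplication

section Search

/-- Two semidecidable alternatives, one of which is known to hold, can be told apart by an unbounded
search for a witness of either. -/
theorem exists_partrec_of_primrecRel {α σ τ : Type*} [Primcodable α] [Primcodable σ]
    [Primcodable τ] {R : α → σ → Prop} {S : α → τ → Prop} (hR : PrimrecRel R)
    (hS : PrimrecRel S) :
    ∃ D : α →. Bool, Partrec D ∧ ∀ a, ((∃ w, R a w) ∨ ∃ w, S a w) →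
      ∃ b ∈ D a, (b = true → ∃ w, R a w) ∧ (b = false → ∃ w, S a w) := by
  classical
  let f : α → ℕ → Option Bool := fun a n =>
    ((Encodable.decode (α := σ) n).bind fun w => if R a w then some true else none) <|>
      ((Encodable.decode (α := τ) n).bind fun w => if S a w then some false else none)
  have hf : Primrec₂ f := by
    refine Primrec.option_orElse.comp ?_ ?_
    · exact Primrec.bind_decode_iff.2
        (Primrec.ite (PrimrecRel.comp hR .fst .snd) (.const _) (.const _)).to₂
    · exact Primrec.bind_decode_iff.2
        (Primrec.ite (PrimrecRel.comp hS .fst .snd) (.const _) (.const _)).to₂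
  refine ⟨_, Partrec.rfindOpt hf.to_comp, fun a ha => ?_⟩
  have hsound : ∀ n b, b ∈ f a n → (b = true → ∃ w, R a w) ∧ (b = false → ∃ w, S a w) := by
    intro n b hb
    rcases (Option.orElse_eq_some _ _ _).1 hb with h | ⟨-, h⟩
    · obtain ⟨w, -, hw⟩ := Option.bind_eq_some_iff.1 h
      split_ifs at hw with hRw
      cases hw
      exact ⟨fun _ => ⟨w, hRw⟩, nofun⟩
    · obtain ⟨w, -, hw⟩ := Option.bind_eq_some_iff.1 h
      split_ifs at hw with hSw
      cases hw
      exact ⟨nofun, fun _ => ⟨w, hSw⟩⟩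
  have hdom : (Nat.rfindOpt (f a)).Dom := by
    rw [Nat.rfindOpt_dom]
    rcases ha with ⟨w, hw⟩ | ⟨w, hw⟩
    · exact ⟨Encodable.encode w, true, by simp [f, hw]⟩
    · refine ⟨Encodable.encode w, ?_⟩
      rcases h : (Encodable.decode (α := σ) (Encodable.encode w)).bind fun w =>
        if R a w then some true else none with _ | b
      · exact ⟨false, by simp [f, h, hw]⟩
      · exact ⟨b, by simp [f, h]⟩
  obtain ⟨b, hb⟩ := Part.dom_iff_mem.1 hdom
  obtain ⟨n, hn⟩ := Nat.rfindOpt_spec hb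
  exact ⟨b, hb, hsound n b hn⟩

end Search

/-! ### Certificates in a number field -/

section Certificates

/-- `w = (f, g, n)` certifies that `P` is invertible modulo `m`, by `f * P + g * m = n ≠ 0`. -/
def IsUnitCert (P m : List ℤ) (w : List ℤ × List ℤ × ℤ) : Prop :=
  w.2.2 ≠ 0 ∧ polyOfList (listSub (listAdd (listMul w.1 P) (listMul w.2.1 m)) [w.2.2]) = 0

/-- `w = (g, n)` certifies that `P` vanishes modulo `m`, by `n * P = m * g` and `n ≠ 0`. -/
def IsZeroCert (P m : List ℤ) (w : List ℤ × ℤ) : Prop :=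
  w.2 ≠ 0 ∧ polyOfList (listSub (listMul [w.2] P) (listMul m w.1)) = 0

theorem isUnitCert_iff {P m : List ℤ} {w : List ℤ × List ℤ × ℤ} :
    IsUnitCert P m w ↔ w.2.2 ≠ 0 ∧
      polyOfList w.1 * polyOfList P + polyOfList w.2.1 * polyOfList m = C w.2.2 := by
  simp [IsUnitCert, sub_eq_zero]

theorem isZeroCert_iff {P m : List ℤ} {w : List ℤ × ℤ} :
    IsZeroCert P m w ↔ w.2 ≠ 0 ∧ C w.2 * polyOfList P = polyOfList m * polyOfList w.1 := by
  simp [IsZeroCert, sub_eq_zero]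

theorem exists_int_smul_eq_map (g : ℚ[X]) : ∃ n : ℤ, n ≠ 0 ∧ ∃ G : List ℤ,
    C (Int.castRingHom ℚ n) * g = (polyOfList G).map (Int.castRingHom ℚ) := by
  obtain ⟨b, hb, e⟩ := IsLocalization.integerNormalization_spec (nonZeroDivisors ℤ) g
  obtain ⟨G, hG⟩ := exists_polyOfList_eq (IsLocalization.integerNormalization (nonZeroDivisors ℤ) g)
  refine ⟨b, nonZeroDivisors.ne_zero hb, G, ?_⟩
  rw [hG, ← algebraMap_int_eq, e, ← algebraMap_smul ℚ b g, smul_eq_C_mul]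

variable {θ : ℂ} {m : List ℤ}

theorem aeval_map_intCast (P : ℤ[X]) : aeval θ (P.map (Int.castRingHom ℚ)) = aeval θ P :=
  aeval_map_algebraMap ℚ θ P

theorem exists_isZeroCert (hm : Irreducible ((polyOfList m).map (Int.castRingHom ℚ)))
    (hθ : aeval θ (polyOfList m) = 0) {P : List ℤ} (hP : aeval θ (polyOfList P) = 0) :
    ∃ w, IsZeroCert P m w := by
  have hdvd : (polyOfList m).map (Int.castRingHom ℚ) ∣ (polyOfList P).map (Int.castRingHom ℚ) := by
    by_contra h
    obtain ⟨f, g, e⟩ := (hm.coprime_iff_not_dvd.2 h)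
    have := congrArg (aeval θ) e
    simp [aeval_map_intCast, hθ, hP] at this
  obtain ⟨g, hg⟩ := hdvd
  obtain ⟨n, hn, G, hG⟩ := exists_int_smul_eq_map g
  refine ⟨(G, n), isZeroCert_iff.2 ⟨hn, ?_⟩⟩
  apply map_injective (Int.castRingHom ℚ) Int.cast_injective
  rw [Polynomial.map_mul, Polynomial.map_mul, map_C, hg, ← hG]
  ring

theorem exists_isUnitCert (hm : Irreducible ((polyOfList m).map (Int.castRingHom ℚ)))
    (hθ : aeval θ (polyOfList m) = 0) {P : List ℤ} (hP : aeval θ (polyOfList P) ≠ 0) :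
    ∃ w, IsUnitCert P m w := by
  have hdvd : ¬ (polyOfList m).map (Int.castRingHom ℚ) ∣
      (polyOfList P).map (Int.castRingHom ℚ) := by
    rintro ⟨g, hg⟩
    apply hP
    rw [← aeval_map_intCast, hg, map_mul, aeval_map_intCast, hθ, zero_mul]
  obtain ⟨f, g, e⟩ := hm.coprime_iff_not_dvd.2 hdvd
  obtain ⟨n₁, hn₁, F, hF⟩ := exists_int_smul_eq_map f
  obtain ⟨n₂, hn₂, G, hG⟩ := exists_int_smul_eq_map g
  refine ⟨(listMul [n₁] G, listMul [n₂] F, n₁ * n₂),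
    isUnitCert_iff.2 ⟨mul_ne_zero hn₁ hn₂, ?_⟩⟩
  apply map_injective (Int.castRingHom ℚ) Int.cast_injective
  simp only [polyOfList_listMul, polyOfList_singleton, Polynomial.map_add, Polynomial.map_mul,
    map_C, ← hF, ← hG, map_mul]
  linear_combination (C (Int.castRingHom ℚ n₁) * C (Int.castRingHom ℚ n₂)) * e

theorem IsZeroCert.aeval_eq_zero {P : List ℤ} {w : List ℤ × ℤ} (h : IsZeroCert P m w)
    (hθ : aeval θ (polyOfList m) = 0) : aeval θ (polyOfList P) = 0 := by
  obtain ⟨hn, e⟩ := isZeroCert_iff.1 h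
  have := congrArg (aeval θ) e
  simpa [hθ, hn] using this

theorem IsUnitCert.aeval_mul {P : List ℤ} {w : List ℤ × List ℤ × ℤ} (h : IsUnitCert P m w)
    (hθ : aeval θ (polyOfList m) = 0) :
    aeval θ (polyOfList w.1) * aeval θ (polyOfList P) = (w.2.2 : ℂ) := by
  have := congrArg (aeval θ) (isUnitCert_iff.1 h).2
  simpa [hθ] using this

theorem IsUnitCert.aeval_ne_zero {P : List ℤ} {w : List ℤ × List ℤ × ℤ} (h : IsUnitCert P m w)
    (hθ : aeval θ (polyOfList m) = 0) : aeval θ (polyOfList P) ≠ 0 := by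
  intro h0
  have := h.aeval_mul hθ
  rw [h0, mul_zero] at this
  exact h.1 (by exact_mod_cast this.symm)

theorem primrecPred_isUnitCert {α : Type*} [Primcodable α] {P m : α → List ℤ}
    {w : α → List ℤ × List ℤ × ℤ} (hP : Primrec P) (hm : Primrec m) (hw : Primrec w) :
    PrimrecPred fun a => IsUnitCert (P a) (m a) (w a) := by
  have hn : Primrec fun a => (w a).2.2 := Primrec.snd.comp (Primrec.snd.comp hw)
  refine (PrimrecPred.not (Primrec.eq.comp hn (.const 0))).and
    (primrecPred_polyOfList_eq_zero.comp (primrec_listSub.comp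
      (primrec_listAdd.comp (primrec_listMul.comp (Primrec.fst.comp hw) hP)
        (primrec_listMul.comp (Primrec.fst.comp (Primrec.snd.comp hw)) hm))
      (Primrec.list_cons.comp hn (.const []))))

theorem primrecPred_isZeroCert {α : Type*} [Primcodable α] {P m : α → List ℤ}
    {w : α → List ℤ × ℤ} (hP : Primrec P) (hm : Primrec m) (hw : Primrec w) :
    PrimrecPred fun a => IsZeroCert (P a) (m a) (w a) := by
  have hn : Primrec fun a => (w a).2 := Primrec.snd.comp hw
  refine (PrimrecPred.not (Primrec.eq.comp hn (.const 0))).and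
    (primrecPred_polyOfList_eq_zero.comp (primrec_listSub.comp
      (primrec_listMul.comp (Primrec.list_cons.comp hn (.const [])) hP)
      (primrec_listMul.comp hm (Primrec.fst.comp hw))))

end Certificates

section Denominators

/-- A nonzero multiple of the leading coefficient of `polyOfList m`: the product of the absolute
values of the nonzero coefficients. -/
def leadMultiple (m : List ℤ) : ℕ := (m.map fun c => max 1 c.natAbs).foldr (· * ·) 1

theorem leadMultiple_pos (m : List ℤ) : 0 < leadMultiple m := by
  induction m with
  | nil => simp [leadMultiple]
  | cons c m ih =>
    rw [leadMultiple, List.map_cons, List.foldr_cons, ← leadMultiple]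
    exact Nat.mul_pos (by omega) ih

theorem natAbs_dvd_leadMultiple {m : List ℤ} {c : ℤ} (hc : c ∈ m) (hc0 : c ≠ 0) :
    c.natAbs ∣ leadMultiple m := by
  induction m with
  | nil => simp at hc
  | cons d m ih =>
    rw [leadMultiple, List.map_cons, List.foldr_cons, ← leadMultiple]
    rcases List.mem_cons.1 hc with rfl | hc
    · rw [max_eq_right (Nat.one_le_iff_ne_zero.2 (Int.natAbs_ne_zero.2 hc0))]
      exact Nat.dvd_mul_right _ _
    · exact (ih hc).mul_left _

theorem primrec_leadMultiple : Primrec leadMultiple :=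
  Primrec.list_foldr (h := fun (_ : List ℤ) (b : ℕ × ℕ) => b.1 * b.2)
    (Primrec.list_map .id (Primrec.nat_max.comp (.const 1) (Primrec.int_natAbs.comp .snd)).to₂)
    (.const 1) (Primrec.nat_mul.comp (Primrec.fst.comp .snd) (Primrec.snd.comp .snd)).to₂

variable {θ : ℂ} {m : List ℤ} (V : ValuationSubring ℂ)

theorem valuation_leadMultiple_mul_le_one (hm0 : polyOfList m ≠ 0)
    (hθ : aeval θ (polyOfList m) = 0) : V.valuation (leadMultiple m * θ) ≤ 1 := by
  have hc0 : (polyOfList m).leadingCoeff ≠ 0 := leadingCoeff_ne_zero.2 hm0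
  have hcm : (polyOfList m).leadingCoeff ∈ m := by
    rw [leadingCoeff, coeff_polyOfList] at hc0 ⊢
    by_cases h : (polyOfList m).natDegree < m.length
    · rw [List.getD_eq_getElem _ _ h]
      exact List.getElem_mem h
    · exact absurd (List.getD_eq_default _ _ (not_lt.1 h)) hc0
  obtain ⟨k, hk⟩ := Int.natAbs_dvd.1 (Int.natCast_dvd_natCast.2 (natAbs_dvd_leadMultiple hcm hc0))
  have hint : IsIntegral ℤ ((polyOfList m).leadingCoeff • θ) := isIntegral_leadingCoeff_smul _ _ hθ
  have hmem : V.valuation ((polyOfList m).leadingCoeff • θ) ≤ 1 :=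
    Valuation.Integers.mem_of_integral (Valuation.integer.integers V.valuation) hint.tower_top
  have e : (leadMultiple m : ℂ) = ((k * (polyOfList m).leadingCoeff : ℤ) : ℂ) := by
    rw [mul_comm k, ← hk, Int.cast_natCast]
  rw [e, Int.cast_mul, mul_assoc, ← zsmul_eq_mul θ, map_mul]
  exact mul_le_one' (valuation_intCast_le_one V k) hmem

/-- The denominator of a value at `θ` of an integer polynomial is bounded by a power of that
of `θ`. -/
theorem valuation_pow_mul_aeval_le_one (hm0 : polyOfList m ≠ 0)
    (hθ : aeval θ (polyOfList m) = 0) (A : List ℤ) :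
    V.valuation ((leadMultiple m : ℂ) ^ A.length * aeval θ (polyOfList A)) ≤ 1 := by
  have h := valuation_leadMultiple_mul_le_one V hm0 hθ
  have hl : V.valuation (leadMultiple m : ℂ) ≤ 1 := by
    exact_mod_cast valuation_intCast_le_one V (leadMultiple m)
  induction A with
  | nil => simp [polyOfList]
  | cons c A ih =>
    have e : (leadMultiple m : ℂ) ^ (c :: A).length * aeval θ (polyOfList (c :: A)) =
        (leadMultiple m : ℂ) ^ (A.length + 1) * c +
          (leadMultiple m * θ) * ((leadMultiple m : ℂ) ^ A.length * aeval θ (polyOfList A)) := by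
      simp only [polyOfList, map_add, map_mul, aeval_X, aeval_C, List.length_cons]
      simp only [algebraMap_int_eq, eq_intCast]
      ring
    rw [e]
    refine V.valuation.map_add_le ?_ ?_
    · rw [map_mul, map_pow]
      exact mul_le_one' (pow_le_one' hl _) (valuation_intCast_le_one V c)
    · rw [map_mul]
      exact mul_le_one' h ih

end Denominators

section NumberField

theorem finrank_adjoin_le {θ : ℂ} {m : List ℤ} (hm0 : polyOfList m ≠ 0)
    (hθ : aeval θ (polyOfList m) = 0) :
    FiniteDimensional ℚ (IntermediateField.adjoin ℚ {θ}) ∧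
      Module.finrank ℚ (IntermediateField.adjoin ℚ {θ}) ≤ m.length := by
  have h0 : (polyOfList m).map (Int.castRingHom ℚ) ≠ 0 :=
    (Polynomial.map_ne_zero_iff Int.cast_injective).2 hm0
  have hθ' : aeval θ ((polyOfList m).map (Int.castRingHom ℚ)) = 0 := by
    rw [aeval_map_intCast, hθ]
  have hint : IsIntegral ℚ θ := IsAlgebraic.isIntegral ⟨_, h0, hθ'⟩
  refine ⟨IntermediateField.adjoin.finiteDimensional hint, ?_⟩
  rw [IntermediateField.adjoin.finrank hint]
  calc _ ≤ ((polyOfList m).map (Int.castRingHom ℚ)).natDegree :=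
        natDegree_le_of_dvd (minpoly.dvd ℚ θ hθ') h0
    _ ≤ (polyOfList m).natDegree := natDegree_map_le
    _ ≤ m.length := natDegree_polyOfList_le m

theorem aeval_mem_adjoin (θ : ℂ) (P : List ℤ) :
    aeval θ (polyOfList P) ∈ IntermediateField.adjoin ℚ {θ} := by
  rw [← aeval_map_intCast]
  exact (IntermediateField.algebra_adjoin_le_adjoin ℚ {θ})
    (aeval_mem_adjoin_singleton ℚ θ)

end NumberField

/-! ### Deciding torsion -/

section Decision

/-- The denominator of the number described by `e`, as a constant polynomial. -/
def denomList (e : ElementCode) : List ℤ := [((e.2 + 1 : ℕ) : ℤ)]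

/-- The polynomial whose value at `θ` vanishes if and only if one of the points `2 ^ k • P` with
`k ≤ N` is zero or two of them have the same abscissa. Here `P` lies on `E_lam`, and `lam` and the
abscissa of `P` are the first and the second number described by `c`. -/
def collisionCode (c : PairCode) (N : ℕ) : List ℤ :=
  listCollisionProd c.2.1.1 (denomList c.2.1) (c.2.2.1, denomList c.2.2) N

/-- The polynomial `A * (A - d)`, whose value at `θ` measures how close `lam = A(θ) / d` is to `0`
and `1`. -/
def discCode (c : PairCode) : List ℤ :=
  listMul c.2.1.1 (listSub c.2.1.1 (denomList c.2.1))

/-- A natural number whose product with `lam` is integral. -/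
def scaleCode (c : PairCode) : ℕ :=
  (c.2.1.2 + 1) * leadMultiple c.1 ^ c.2.1.1.length

/-- The number of points `2 ^ k • P` among which a collision has to occur if `P` is torsion. It
depends on a certificate `w` for `lam ≠ 0, 1`. The exponent is that of
`exists_eq_of_isTorsionX`, with `q` and `s` read off from `w` and from the denominators; two more
points ensure that none of the points counted there has order dividing four. -/
def collisionBound (c : PairCode) (w : List ℤ × List ℤ × ℤ) : ℕ :=
  2 ^ (c.1.length * (4 * (w.2.2.natAbs * leadMultiple c.1 ^ w.1.length) ^ 3 *
    scaleCode c ^ 10)) + 2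

/-- `w` certifies that the second number described by `c` is the abscissa of a torsion point on the
curve given by the first number. -/
def IsTorsionCert (c : PairCode) (w : ℕ × List ℤ × ℤ) : Prop :=
  IsZeroCert (collisionCode c w.1) c.1 w.2

/-- `w` certifies that the second number described by `c` is not the abscissa of a torsion point on
the curve given by the first number. -/
def IsNonTorsionCert (c : PairCode)
    (w : (List ℤ × List ℤ × ℤ) × (List ℤ × List ℤ × ℤ)) : Prop :=
  IsUnitCert (discCode c) c.1 w.1 ∧
    IsUnitCert (collisionCode c (collisionBound c w.1)) c.1 w.2

theorem primrec_denomList : Primrec denomList :=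
  Primrec.list_cons.comp (Primrec.int_ofNat.comp (Primrec.succ.comp .snd)) (.const [])

theorem primrec_collisionCode {α : Type*} [Primcodable α] {c : α → PairCode} {N : α → ℕ}
    (hc : Primrec c) (hN : Primrec N) : Primrec fun a => collisionCode (c a) (N a) := by
  have h1 : Primrec fun a => (c a).2.1 := Primrec.fst.comp (Primrec.snd.comp hc)
  have h2 : Primrec fun a => (c a).2.2 := Primrec.snd.comp (Primrec.snd.comp hc)
  exact primrec_listCollisionProd (Primrec.fst.comp h1) (primrec_denomList.comp h1)
    ((Primrec.fst.comp h2).pair (primrec_denomList.comp h2)) hN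

theorem primrec_discCode : Primrec discCode := by
  have h1 : Primrec fun c : PairCode => c.2.1 := Primrec.fst.comp .snd
  exact primrec_listMul.comp (Primrec.fst.comp h1)
    (primrec_listSub.comp (Primrec.fst.comp h1) (primrec_denomList.comp h1))

theorem primrec_scaleCode : Primrec scaleCode := by
  have h1 : Primrec fun c : PairCode => c.2.1 := Primrec.fst.comp .snd
  exact Primrec.nat_mul.comp (Primrec.succ.comp (Primrec.snd.comp h1))
    (Primrec.nat_pow.comp (primrec_leadMultiple.comp .fst)
      (Primrec.list_length.comp (Primrec.fst.comp h1)))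

theorem primrec_collisionBound : Primrec₂ collisionBound := by
  have hm : Primrec fun a : PairCode × List ℤ × List ℤ × ℤ => a.1.1 := Primrec.fst.comp .fst
  have hn : Primrec fun a : PairCode × List ℤ × List ℤ × ℤ => a.2.2.2 :=
    Primrec.snd.comp (Primrec.snd.comp .snd)
  have hq := Primrec.nat_mul.comp (Primrec.int_natAbs.comp hn)
    (Primrec.nat_pow.comp (primrec_leadMultiple.comp hm)
      (Primrec.list_length.comp (Primrec.fst.comp .snd)))
  exact Primrec.nat_add.comp (Primrec.nat_pow.comp (.const 2)
    (Primrec.nat_mul.comp (Primrec.list_length.comp hm)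
      (Primrec.nat_mul.comp (Primrec.nat_mul.comp (.const 4) (Primrec.nat_pow.comp hq (.const 3)))
        (Primrec.nat_pow.comp (primrec_scaleCode.comp .fst) (.const 10))))) (.const 2)

theorem primrecRel_isTorsionCert : PrimrecRel IsTorsionCert :=
  primrecPred_isZeroCert (primrec_collisionCode .fst (Primrec.fst.comp .snd))
    (Primrec.fst.comp .fst) (Primrec.snd.comp .snd)

theorem primrecRel_isNonTorsionCert : PrimrecRel IsNonTorsionCert :=
  (primrecPred_isUnitCert (primrec_discCode.comp .fst) (Primrec.fst.comp .fst)
    (Primrec.fst.comp .snd)).and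
  (primrecPred_isUnitCert (primrec_collisionCode .fst
    (primrec_collisionBound.comp .fst (Primrec.fst.comp .snd))) (Primrec.fst.comp .fst)
    (Primrec.snd.comp .snd))

theorem aeval_denomList (θ : ℂ) (e : ElementCode) :
    aeval θ (polyOfList (denomList e)) = (e.2 : ℂ) + 1 := by
  simp [denomList]

theorem coe_value (θ : QBar) (e : ElementCode) :
    ((ElementCode.value θ e : QBar) : ℂ) =
      aeval (θ : ℂ) (polyOfList e.1) / aeval (θ : ℂ) (polyOfList (denomList e)) := by
  have h : aeval (θ : ℂ) (polyOfList e.1) = ((aeval θ (polyOfList e.1) : QBar) : ℂ) :=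
    aeval_algebraMap_apply ℂ θ (polyOfList e.1)
  rw [aeval_denomList, h, ElementCode.value]
  push_cast
  rfl

theorem aeval_denomList_ne_zero (θ : ℂ) (e : ElementCode) :
    aeval θ (polyOfList (denomList e)) ≠ 0 := by
  rw [aeval_denomList]
  exact Nat.cast_add_one_ne_zero e.2

theorem aeval_collisionCode (θ : ℂ) (c : PairCode) (N : ℕ) :
    aeval θ (polyOfList (collisionCode c N)) =
      collisionProd (doubleOrbit (aeval θ (polyOfList c.2.1.1))
        (aeval θ (polyOfList (denomList c.2.1)))
        (aeval θ (polyOfList c.2.2.1), aeval θ (polyOfList (denomList c.2.2)))) N := by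
  have := map_collisionProd ((aeval θ : ℤ[X] →ₐ[ℤ] ℂ) : ℤ[X] →+* ℂ)
    (doubleOrbit (polyOfList c.2.1.1) (polyOfList (denomList c.2.1))
      (polyOfList c.2.2.1, polyOfList (denomList c.2.2))) N
  simp only [map_doubleOrbit] at this
  rw [collisionCode, polyOfList_listCollisionProd]
  exact this

variable {c : PairCode} {θ lam β : QBar}

theorem PairCode.Describes.aeval_eq_zero (h : c.Describes θ lam β) :
    aeval (θ : ℂ) (polyOfList c.1) = 0 := by
  have := aeval_algebraMap_apply ℂ θ (polyOfList c.1)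
  rw [h.2.1, map_zero] at this
  exact this

theorem PairCode.Describes.coe_fst (h : c.Describes θ lam β) : (lam : ℂ) =
    aeval (θ : ℂ) (polyOfList c.2.1.1) / aeval (θ : ℂ) (polyOfList (denomList c.2.1)) := by
  rw [← h.2.2.1, coe_value]

theorem PairCode.Describes.coe_snd (h : c.Describes θ lam β) : (β : ℂ) =
    aeval (θ : ℂ) (polyOfList c.2.2.1) / aeval (θ : ℂ) (polyOfList (denomList c.2.2)) := by
  rw [← h.2.2.2, coe_value]

theorem isTorsionX_of_isTorsionCert (h : c.Describes θ lam β) (h0 : lam ≠ 0) (h1 : lam ≠ 1)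
    {w : ℕ × List ℤ × ℤ} (hw : IsTorsionCert c w) : IsTorsionX (lam : ℂ) (β : ℂ) := by
  have h0 : (lam : ℂ) ≠ 0 := by exact_mod_cast h0
  have h1 : (lam : ℂ) ≠ 1 := by exact_mod_cast h1
  have hz := hw.aeval_eq_zero h.aeval_eq_zero
  rw [aeval_collisionCode] at hz
  obtain ⟨y, P⟩ := legendreCurve.exists_nonsingular h0 h1 (β : ℂ)
  exact ⟨y, P, isOfFinAddOrder_of_collisionProd_eq_zero h0 h1 (aeval_denomList_ne_zero _ _)
    h.coe_fst P (aeval_denomList_ne_zero _ _) h.coe_snd hz⟩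

theorem not_isTorsionX_of_isNonTorsionCert (i : QBar →+* PadicAlgCl 2)
    (h : c.Describes θ lam β) (h0 : lam ≠ 0) (h1 : lam ≠ 1)
    {w : (List ℤ × List ℤ × ℤ) × (List ℤ × List ℤ × ℤ)} (hw : IsNonTorsionCert c w) :
    ¬ IsTorsionX (lam : ℂ) (β : ℂ) := by
  have h0 : (lam : ℂ) ≠ 0 := by exact_mod_cast h0
  have h1 : (lam : ℂ) ≠ 1 := by exact_mod_cast h1
  rintro ⟨y, P, hP⟩
  obtain ⟨V, hV⟩ := exists_valuationSubring i
  have hv := valuation_two_lt_one hV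
  have hθ := h.aeval_eq_zero
  have hm0 : polyOfList c.1 ≠ 0 := by
    intro h'
    apply h.1.ne_zero
    rw [h', Polynomial.map_zero]
  obtain ⟨hfin, hrank⟩ := finrank_adjoin_le hm0 hθ
  refine hw.2.aeval_ne_zero hθ ?_
  have hlam := h.coe_fst
  have hd := aeval_denomList_ne_zero (θ : ℂ) c.2.1
  have hd' := aeval_denomList (θ : ℂ) c.2.1
  have hl0 : (leadMultiple c.1 : ℤ) ≠ 0 := by exact_mod_cast (leadMultiple_pos c.1).ne'
  have hn0 : w.1.2.2 ≠ 0 := hw.1.1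
  have hden := hw.1.aeval_mul hθ
  have hu := valuation_pow_mul_aeval_le_one V hm0 hθ w.1.1
  have hA := valuation_pow_mul_aeval_le_one V hm0 hθ c.2.1.1
  rw [discCode, polyOfList_listMul, polyOfList_listSub, map_mul, map_sub] at hden
  have hD1 : V.valuation (aeval (θ : ℂ) (polyOfList (denomList c.2.1))) ≤ 1 := by
    rw [hd']
    exact_mod_cast valuation_intCast_le_one V (c.2.1.2 + 1)
  rw [aeval_collisionCode, collisionBound]
  refine collisionProd_eq_zero_of_isOfFinAddOrder hv h0 h1 hd hlam
    (s := ((scaleCode c : ℕ) : ℤ)) (q := w.1.2.2 * (leadMultiple c.1 : ℤ) ^ w.1.1.length)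
    ?_ (mul_ne_zero hn0 (pow_ne_zero _ hl0)) ?_ ?_ (IntermediateField.adjoin ℚ {(θ : ℂ)}) hrank ?_
    (aeval_mem_adjoin _ _) (aeval_mem_adjoin _ _) ⟨aeval_mem_adjoin _ _, aeval_mem_adjoin _ _⟩
    P (aeval_denomList_ne_zero _ _) h.coe_snd hP
  · exact_mod_cast (Nat.mul_pos c.2.1.2.succ_pos (pow_pos (leadMultiple_pos c.1) _)).ne'
  · -- `scaleCode c * lam` is the numerator of `lam` times a power of `leadMultiple c.1`.
    have e : (((scaleCode c : ℕ) : ℤ) : ℂ) * (lam : ℂ) =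
        (leadMultiple c.1 : ℂ) ^ c.2.1.1.length * aeval (θ : ℂ) (polyOfList c.2.1.1) := by
      rw [hlam, hd', scaleCode]
      rw [hd'] at hd
      push_cast
      field_simp
    rw [e]
    exact hA
  · set d := aeval (θ : ℂ) (polyOfList (denomList c.2.1))
    set A := aeval (θ : ℂ) (polyOfList c.2.1.1)
    set u := aeval (θ : ℂ) (polyOfList w.1.1)
    -- Up to an integral factor, `q` is a multiple of `A (A - d) = -d² lam (1 - lam)`.
    have e : ((w.1.2.2 * (leadMultiple c.1 : ℤ) ^ w.1.1.length : ℤ) : ℂ) =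
        ((leadMultiple c.1 : ℂ) ^ w.1.1.length * u) * (-d * d) * (lam * (1 - lam)) := by
      push_cast
      rw [← hden, hlam]
      field_simp
      ring
    rw [e, map_mul]
    refine mul_le_of_le_one_left' ?_
    rw [map_mul, map_mul V.valuation (-d), Valuation.map_neg]
    exact mul_le_one' hu (mul_le_one' hD1 hD1)
  · simp [Int.natAbs_mul, Int.natAbs_pow]

/-- One of the two kinds of certificate always exists. -/
theorem exists_cert (h : c.Describes θ lam β) (h0 : lam ≠ 0) (h1 : lam ≠ 1) :
    (∃ w, IsTorsionCert c w) ∨ ∃ w, IsNonTorsionCert c w := by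
  by_cases hN : ∃ N, aeval (θ : ℂ) (polyOfList (collisionCode c N)) = 0
  · obtain ⟨N, hN⟩ := hN
    obtain ⟨w, hw⟩ := exists_isZeroCert h.1 h.aeval_eq_zero hN
    exact Or.inl ⟨(N, w), hw⟩
  · push Not at hN
    have hdisc : aeval (θ : ℂ) (polyOfList (discCode c)) ≠ 0 := by
      have hlam := h.coe_fst
      have hd := aeval_denomList_ne_zero (θ : ℂ) c.2.1
      rw [discCode, polyOfList_listMul, polyOfList_listSub, map_mul, map_sub]
      refine mul_ne_zero (fun h' => h0 ?_) (sub_ne_zero.2 fun h' => h1 ?_)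
      · rw [h', zero_div] at hlam
        exact_mod_cast hlam
      · rw [h', div_self hd] at hlam
        exact_mod_cast hlam
    obtain ⟨w₁, hw₁⟩ := exists_isUnitCert h.1 h.aeval_eq_zero hdisc
    obtain ⟨w₂, hw₂⟩ := exists_isUnitCert h.1 h.aeval_eq_zero (hN (collisionBound c w₁))
    exact Or.inr ⟨(w₁, w₂), hw₁, hw₂⟩

/-- A single algorithm decides whether `β` is the abscissa of a torsion point of `E_lam`. -/
theorem exists_decision :
    ∃ D : PairCode →. Bool, Partrec D ∧ ∀ (_ : QBar →+* PadicAlgCl 2) (c : PairCode)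
      (θ lam β : QBar), lam ≠ 0 → lam ≠ 1 → c.Describes θ lam β →
        ∃ b ∈ D c, (b = true ↔ IsTorsionX (lam : ℂ) (β : ℂ)) := by
  obtain ⟨D, hD, H⟩ :=
    exists_partrec_of_primrecRel primrecRel_isTorsionCert primrecRel_isNonTorsionCert
  refine ⟨D, hD, fun i c θ lam β h0 h1 h => ?_⟩
  obtain ⟨b, hb, ht, hf⟩ := H c (exists_cert h h0 h1)
  refine ⟨b, hb, fun hbt => ?_, fun hT => ?_⟩
  · obtain ⟨w, hw⟩ := ht hbt
    exact isTorsionX_of_isTorsionCert h h0 h1 hw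
  · by_contra hbf
    obtain ⟨w, hw⟩ := hf (Bool.eq_false_of_not_eq_true hbf)
    exact not_isTorsionX_of_isNonTorsionCert i h h0 h1 hw hT

end Decision

theorem mem_torsionParams_self {α : ℂ} (h0 : α ≠ 0) (h1 : α ≠ 1) : α ∈ torsionParams α :=
  ⟨h0, h1, 0, legendreCurve.exists_isOfFinAddOrder_branch h0 h1 (Or.inr (Or.inr rfl))⟩

theorem mainTheorem2 :
    (∀ (i : QBar →+* PadicAlgCl 2) (α β : QBar),
      α ≠ 0 → α ≠ 1 → β ≠ 0 → β ≠ 1 → reduction i α ≠ reduction i β →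
        simultaneousTorsionParams (α : ℂ) (β : ℂ) ⊆ {(α : ℂ), (β : ℂ)} ∧
        (simultaneousTorsionParams (α : ℂ) (β : ℂ)).Finite) ∧
    (∃ F : PairCode →. List ElementCode, Partrec F ∧
      ∀ (i : QBar →+* PadicAlgCl 2) (α β : QBar),
        α ≠ 0 → α ≠ 1 → β ≠ 0 → β ≠ 1 → reduction i α ≠ reduction i β →
          ∀ (c : PairCode) (θ : QBar), c.Describes θ α β →
            ∃ l ∈ F c,
              simultaneousTorsionParams (α : ℂ) (β : ℂ) =
                {lam : ℂ | ∃ e ∈ l, lam = (ElementCode.value θ e : ℂ)}) := by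
  refine ⟨fun i α β hα0 hα1 hβ0 hβ1 h => ?_, ?_⟩
  · have hsub := simultaneousTorsionParams_subset hα0 hα1 hβ0 hβ1 h
    exact ⟨hsub, (Set.toFinite _).subset hsub⟩
  obtain ⟨D, hD, H⟩ := exists_decision
  let swap : PairCode → PairCode := fun c => (c.1, c.2.2, c.2.1)
  let out : PairCode → Bool → Bool → List ElementCode := fun c b₁ b₂ =>
    (bif b₁ then [c.2.1] else []) ++ (bif b₂ then [c.2.2] else [])
  have hswap : Primrec swap :=
    Primrec.fst.pair ((Primrec.snd.comp .snd).pair (Primrec.fst.comp .snd))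
  have hout : Primrec fun a : (PairCode × Bool) × Bool => out a.1.1 a.1.2 a.2 := by
    refine Primrec.list_append.comp (Primrec.cond (Primrec.snd.comp .fst) ?_ (.const []))
      (Primrec.cond .snd ?_ (.const []))
    · exact Primrec.list_cons.comp
        (Primrec.fst.comp (Primrec.snd.comp (Primrec.fst.comp .fst))) (.const [])
    · exact Primrec.list_cons.comp
        (Primrec.snd.comp (Primrec.snd.comp (Primrec.fst.comp .fst))) (.const [])
  refine ⟨fun c => (D c).bind fun b₁ => (D (swap c)).map fun b₂ => out c b₁ b₂, ?_, ?_⟩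
  · have hF : Partrec₂ fun (c : PairCode) (b₁ : Bool) =>
        (D (swap c)).map fun b₂ => out c b₁ b₂ :=
      Partrec.map (f := fun a : PairCode × Bool => D (swap a.1))
        (g := fun a b₂ => out a.1 a.2 b₂) (hD.comp (hswap.to_comp.comp .fst)) hout.to_comp
    exact Partrec.bind hD hF
  intro i α β hα0 hα1 hβ0 hβ1 h c θ hc
  have hc' : (swap c).Describes θ β α := ⟨hc.1, hc.2.1, hc.2.2.2, hc.2.2.1⟩
  obtain ⟨b₁, hb₁, e₁⟩ := H i c θ α β hα0 hα1 hc
  obtain ⟨b₂, hb₂, e₂⟩ := H i (swap c) θ β α hβ0 hβ1 hc'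
  refine ⟨out c b₁ b₂, Part.mem_bind_iff.2 ⟨b₁, hb₁, Part.mem_map_iff _ |>.2 ⟨b₂, hb₂, rfl⟩⟩, ?_⟩
  have hα0' : (α : ℂ) ≠ 0 := by exact_mod_cast hα0
  have hα1' : (α : ℂ) ≠ 1 := by exact_mod_cast hα1
  have hβ0' : (β : ℂ) ≠ 0 := by exact_mod_cast hβ0
  have hβ1' : (β : ℂ) ≠ 1 := by exact_mod_cast hβ1
  -- As `α ∈ T(α)`, membership of `α` in `T(α, β)` amounts to `α ∈ T(β)`, and likewise for `β`.
  have memα : (α : ℂ) ∈ simultaneousTorsionParams (α : ℂ) (β : ℂ) ↔ b₁ = true := by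
    rw [e₁]
    exact ⟨fun hm => hm.2.2.2, fun hT =>
      ⟨mem_torsionParams_self hα0' hα1', hα0', hα1', hT⟩⟩
  have memβ : (β : ℂ) ∈ simultaneousTorsionParams (α : ℂ) (β : ℂ) ↔ b₂ = true := by
    rw [e₂]
    exact ⟨fun hm => hm.1.2.2, fun hT =>
      ⟨⟨hβ0', hβ1', hT⟩, mem_torsionParams_self hβ0' hβ1'⟩⟩
  have hout_mem : ∀ e, e ∈ out c b₁ b₂ ↔ (b₁ = true ∧ e = c.2.1) ∨ (b₂ = true ∧ e = c.2.2) := by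
    intro e
    cases b₁ <;> cases b₂ <;> simp [out]
  ext lam
  simp only [Set.mem_ofPred_eq, hout_mem]
  constructor
  · intro hlam
    rcases simultaneousTorsionParams_subset hα0 hα1 hβ0 hβ1 h hlam with rfl | rfl
    · exact ⟨_, Or.inl ⟨memα.1 hlam, rfl⟩, by rw [hc.2.2.1]⟩
    · exact ⟨_, Or.inr ⟨memβ.1 hlam, rfl⟩, by rw [hc.2.2.2]⟩
  · rintro ⟨e, ⟨hb, rfl⟩ | ⟨hb, rfl⟩, rfl⟩
    · rw [hc.2.2.1]
      exact memα.2 hb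
    · rw [hc.2.2.2]
      exact memβ.2 hb
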